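/- Let $M$ be a smooth manifold of dimension $n$ (Hausdorff, second countable, without boundary). For a bivector field $\pi$ let $\pi^\sharp:T^*M\to TM$ be given by $\langle\beta,\pi^\sharp\alpha\rangle=\pi(\alpha,\beta)$. A twisted Poisson structure on $M$ is a pair $(\pi,\psi)$ of a smooth bivector field $\pi$ and a smooth closed $3$-form $\psi$ with $\tfrac12[\pi,\pi]=(\wedge^3\pi^\sharp)\psi$. For a volume form $\lambda$ on $M$ (or a smooth nowhere-vanishing density $\lambda$, e.g. when $M$ is not orientable), the modular vector field is $Z_{\pi,\psi,\lambda}=X_{\pi,\lambda}+Y_{\pi,\psi}$, where for all $1$-forms $\alpha$ $$\langle\alpha,X_{\pi,\lambda}\rangle\,\lambda=\mathcal L_{\pi^\sharp\alpha}\lambda-(i_\pi d\alpha)\,\lambda,\qquad \langle\alpha,Y_{\pi,\psi}\rangle=\tfrac12\operatorname{Tr}\bigl(\beta\mapsto\psi(\pi^\sharp\alpha,\pi^\sharp\beta,\cdot\,)\bigr),$$ with the convention $i_\pi(\alpha\wedge\beta)=-\pi(\alpha,\beta)$. A vector field is in the modular class of $(TM,\pi,\psi)$ if it differs from some $Z_{\pi,\psi,\lambda}$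 by a hamiltonian vector field $H_g=\pi^\sharp(dg)$, $g\in C^\infty(M)$. Let $(\pi,\psi)$ be a twisted Poisson structure on $M$ and let $B$ be a smooth $2$-form such that at every point of $M$ the endomorphism $\sigma_B:\alpha\mapsto\alpha+i_{\pi^\sharp\alpha}B$ of the cotangent space is invertible. Let $(\pi',\psi-dB)$ be obtained from $(\pi,\psi)$ by the gauge transformation by $B$, that is, $(\pi')^\sharp=\pi^\sharp(\mathrm{Id}+B^\flat\circ\pi^\sharp)^{-1}$ with $B^\flat(X)=i_XB$. **Proposition.** A smooth vector field $X$ on $M$ is in the modular class of $(TM,\pi',\psi-dB)$ if and only if $X+\pi^\sharp i_XB$ is in the modular class of $(TM,\pi,\psi)$. -/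

import Mathlib

open scoped Manifold ContDiff Topology

noncomputable section

namespace TwistedPoisson

/-- The model space `ℝⁿ`. -/
abbrev Model (n : ℕ) : Type := EuclideanSpace ℝ (Fin n)

/-- The coordinate vectors of `ℝⁿ`. -/
def e {n : ℕ} (i : Fin n) : Model n := EuclideanSpace.single i 1

/-- The coordinate covectors of `ℝⁿ`. -/
def ε {n : ℕ} (i : Fin n) : Model n →L[ℝ] ℝ := EuclideanSpace.proj i

theorem covector_eq_sum {n : ℕ} (α : Model n →L[ℝ] ℝ) : α = ∑ i, α (e i) • ε i := by
  ext v
  have hv : v = ∑ i, v i • e i := by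
    ext j
    simp [e, Pi.single_apply]
  conv_lhs => rw [hv]
  simp [map_sum, ε, mul_comm, sum_apply]

section Manifold

variable {n : ℕ} {M : Type*} [TopologicalSpace M] [ChartedSpace (Model n) M]

variable (n) in
/-- The tangent space of `M` at `m`. -/
abbrev Tan (m : M) : Type := TangentSpace (𝓡 n) m

variable (n) in
/-- The cotangent space of `M` at `m`. -/
abbrev Cotan (m : M) : Type := Tan n m →L[ℝ] ℝ

variable (n M) in
/-- (Not necessarily smooth) vector fields on `M`. -/
abbrev VectorField : Type _ := ∀ m : M, Tan n m

variable (n M) in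
/-- (Not necessarily smooth) `1`-forms on `M`, as fields of covectors. -/
abbrev CovectorField : Type _ := ∀ m : M, Cotan n m

variable (n M) in
/-- (Not necessarily smooth) differential `k`-forms on `M`. -/
abbrev Form (k : ℕ) : Type _ := ∀ m : M, Tan n m [⋀^Fin k]→L[ℝ] ℝ

variable (n M) in
/-- Fields of linear maps `T*M → TM`. A bivector field `π` is given by its map `π♯`, where
`⟨β, π♯ α⟩ = π(α, β)`; see `IsBivectorField`. -/
abbrev SharpField : Type _ := ∀ m : M, Cotan n m →ₗ[ℝ] Tan n m

variable (n M) in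
/-- Fields of real functions of `n` tangent vectors; these contain both the forms of top degree
and the densities, see `IsVolume`. -/
abbrev VolumeField : Type _ := ∀ m : M, (Fin n → Tan n m) → ℝ

/-! ### Expressions in the chart at a point `c` -/

/-- The differential at `φ⁻¹ y` of the chart `φ` at `c`. -/
def dChart (c : M) (y : Model n) : Tan n ((extChartAt (𝓡 n) c).symm y) →L[ℝ] Model n :=
  mfderiv (𝓡 n) 𝓘(ℝ, Model n) (extChartAt (𝓡 n) c) ((extChartAt (𝓡 n) c).symm y)

/-- The differential at `y` of the inverse of the chart at `c`. -/
def dChartSymm (c : M) (y : Model n) : Model n →L[ℝ] Tan n ((extChartAt (𝓡 n) c).symm y) :=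
  mfderiv 𝓘(ℝ, Model n) (𝓡 n) (extChartAt (𝓡 n) c).symm y

/-- A vector field read in the chart at `c`. -/
def VectorField.inChart (V : VectorField n M) (c : M) (y : Model n) : Model n :=
  dChart c y (V ((extChartAt (𝓡 n) c).symm y))

/-- A differential form read in the chart at `c`. -/
def Form.inChart {k : ℕ} (τ : Form n M k) (c : M) (y : Model n) : Model n [⋀^Fin k]→L[ℝ] ℝ :=
  (τ ((extChartAt (𝓡 n) c).symm y)).compContinuousLinearMap (dChartSymm c y)

/-- A bivector field (through `π♯`) read in the chart at `c`. -/
def SharpField.inChart (π : SharpField n M) (c : M) (y : Model n) (ξ : Model n →L[ℝ] ℝ) :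
    Model n :=
  dChart c y (π ((extChartAt (𝓡 n) c).symm y) (ξ ∘L dChart c y))

/-- The value of a volume form or density on the coordinate frame of the chart at `c`. -/
def VolumeField.inChart (μ : VolumeField n M) (c : M) (y : Model n) : ℝ :=
  μ ((extChartAt (𝓡 n) c).symm y) (fun i => dChartSymm c y (e i))

/-! ### Smooth objects -/

/-- Smooth vector fields. -/
def VectorField.IsSmooth (V : VectorField n M) : Prop :=
  ∀ c : M, ContDiffOn ℝ ∞ (V.inChart c) (extChartAt (𝓡 n) c).target

/-- Smooth differential forms. -/
def Form.IsSmooth {k : ℕ} (τ : Form n M k) : Prop :=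
  ∀ c : M, ContDiffOn ℝ ∞ (τ.inChart c) (extChartAt (𝓡 n) c).target

/-- A field of covectors as a differential form of degree `1`. -/
def CovectorField.toForm (α : CovectorField n M) : Form n M 1 :=
  fun m => ContinuousAlternatingMap.ofSubsingleton ℝ (Tan n m) ℝ (0 : Fin 1) (α m)

/-- `π♯` is the map of a smooth bivector field `π`, i.e. it is skew-symmetric and smooth. -/
structure IsBivectorField (π : SharpField n M) : Prop where
  skew : ∀ (m : M) (α β : Cotan n m), β (π m α) = -α (π m β)
  smooth : ∀ (c : M) (ξ : Model n →L[ℝ] ℝ),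
    ContDiffOn ℝ ∞ (fun y => π.inChart c y ξ) (extChartAt (𝓡 n) c).target

/-- Volume forms, that is, smooth nowhere-vanishing forms of top degree, and smooth
nowhere-vanishing densities (which replace them when `M` is not orientable). -/
structure IsVolume (μ : VolumeField n M) : Prop where
  form_or_density :
    (∃ lam : Form n M n, ∀ m v, μ m v = lam m v) ∨
    (∀ (m : M) (A : Tan n m →ₗ[ℝ] Tan n m) (v : Fin n → Tan n m),
      μ m (fun i => A (v i)) = |LinearMap.det A| * μ m v)
  ne_zero : ∀ m : M, μ m ≠ 0
  smooth : ∀ c : M, ContDiffOn ℝ ∞ (μ.inChart c) (extChartAt (𝓡 n) c).target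

/-! ### Exterior derivative, interiorBivector products, Lie derivative -/

/-- The exterior derivative of a differential form, computed at `m` in the chart at `m`. -/
def Form.d {k : ℕ} (τ : Form n M k) : Form n M (k + 1) := fun m =>
  (extDeriv (τ.inChart m) (extChartAt (𝓡 n) m m)).compContinuousLinearMap
    (mfderiv (𝓡 n) 𝓘(ℝ, Model n) (extChartAt (𝓡 n) m) m :
      Tan n m →L[ℝ] Model n)

/-- The map `X ↦ i_X τ = τ(X, ·)` of a `2`-form `τ` on `T_m M`. -/
def flat {m : M} (τ : Tan n m [⋀^Fin 2]→L[ℝ] ℝ) : Tan n m →ₗ[ℝ] Cotan n m where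
  toFun X := τ.toContinuousLinearMap ![X, 0] 1
  map_add' X Y := by
    ext v
    have h (X : Tan n m) : Function.update ![X, 0] 1 v = Function.update ![0, v] 0 X := by
      ext i; fin_cases i <;> rfl
    simp only [ContinuousAlternatingMap.toContinuousLinearMap_apply, h,
      add_apply]
    exact τ.map_update_add _ _ _ _
  map_smul' a X := by
    ext v
    have h (X : Tan n m) : Function.update ![X, 0] 1 v = Function.update ![0, v] 0 X := by
      ext i; fin_cases i <;> rfl
    simp only [ContinuousAlternatingMap.toContinuousLinearMap_apply, h,
      smul_apply, RingHom.id_apply]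
    exact τ.map_update_smul _ _ _ _

theorem flat_apply {m : M} (τ : Tan n m [⋀^Fin 2]→L[ℝ] ℝ) (X Y : Tan n m) :
    flat τ X Y = τ ![X, Y] := by
  have h : Function.update ![X, 0] 1 Y = ![X, Y] := by
    ext i; fin_cases i <;> rfl
  change τ (Function.update ![X, 0] 1 Y) = _
  rw [h]

/-- The map `Y ↦ i_Y i_X ψ = ψ(X, Y, ·)` of a `3`-form `ψ` and a vector `X` on `T_m M`. -/
def flat₃ {m : M} (ψ : Tan n m [⋀^Fin 3]→L[ℝ] ℝ) (X : Tan n m) : Tan n m →ₗ[ℝ] Cotan n m where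
  toFun Y := ψ.toContinuousLinearMap ![X, Y, 0] 2
  map_add' Y Z := by
    ext v
    have h (Y : Tan n m) : Function.update ![X, Y, 0] 2 v = Function.update ![X, 0, v] 1 Y := by
      ext i; fin_cases i <;> rfl
    simp only [ContinuousAlternatingMap.toContinuousLinearMap_apply, h,
      add_apply]
    exact ψ.map_update_add _ _ _ _
  map_smul' a Y := by
    ext v
    have h (Y : Tan n m) : Function.update ![X, Y, 0] 2 v = Function.update ![X, 0, v] 1 Y := by
      ext i; fin_cases i <;> rfl
    simp only [ContinuousAlternatingMap.toContinuousLinearMap_apply, h,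
      smul_apply, RingHom.id_apply]
    exact ψ.map_update_smul _ _ _ _

theorem flat₃_apply {m : M} (ψ : Tan n m [⋀^Fin 3]→L[ℝ] ℝ) (X Y Z : Tan n m) :
    flat₃ ψ X Y Z = ψ ![X, Y, Z] := by
  have h : Function.update ![X, Y, 0] 2 Z = ![X, Y, Z] := by
    ext i; fin_cases i <;> rfl
  change ψ (Function.update ![X, Y, 0] 2 Z) = _
  rw [h]

/-- The interior product `i_π τ` of a `2`-form by a bivector: for `π = ½ ∑ e_k ∧ π♯ ε^k` and
`i_{X ∧ Y} = i_X ∘ i_Y` it is `½ ∑ τ(π♯ ε^k, e_k)`, half the trace of `ξ ↦ i_{π♯ ξ} τ`. -/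
def interiorBivector (π : SharpField n M) (τ : Form n M 2) (m : M) : ℝ :=
  (1 / 2) * LinearMap.trace ℝ (Cotan n m) (flat (τ m) ∘ₗ π m)

/-- The divergence of `V` with respect to `μ`: if `μ` is `ℓ dx¹ ⋯ dxⁿ` in the chart at `m`, it
is `ℓ⁻¹ ∑ ∂(ℓ Vⁱ)/∂xⁱ`. -/
def divergence (μ : VolumeField n M) (V : VectorField n M) (m : M) : ℝ :=
  (∑ i : Fin n, fderiv ℝ (fun y => μ.inChart m y * (V.inChart m y) i)
    (extChartAt (𝓡 n) m m) (e i)) / μ.inChart m (extChartAt (𝓡 n) m m)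

/-- The Lie derivative of a volume form or density along a vector field. -/
def lieDeriv (V : VectorField n M) (μ : VolumeField n M) : VolumeField n M :=
  fun m v => divergence μ V m * μ m v

/-! ### Twisted Poisson structures -/

/-- The trivector `u ∧ v ∧ w` on `ℝⁿ`, as a function of three covectors. -/
def wedge₃ (u v w : Model n) (η : Fin 3 → (Model n →L[ℝ] ℝ)) : ℝ :=
  Matrix.det (Matrix.of fun a b => η a (![u, v, w] b))

/-- The Schouten (Gerstenhaber) bracket `[π, π]` on `ℝⁿ` at `y`, where
`π = ½ ∑ e_i ∧ V_i` with `V_i = π♯ ε^i`, from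
`[a₁ ∧ a₂, b₁ ∧ b₂] = ∑ (-1)^(k+l) [a_k, b_l] ∧ a_{k'} ∧ b_{l'}`. -/
def schouten (p : Model n → (Model n →L[ℝ] ℝ) → Model n) (y : Model n)
    (η : Fin 3 → (Model n →L[ℝ] ℝ)) : ℝ :=
  let E : Fin n → Model n → Model n := fun i _ => e i
  let V : Fin n → Model n → Model n := fun i z => p z (ε i)
  (1 / 4) * ∑ i, ∑ j,
    (wedge₃ (VectorField.lieBracket ℝ (E i) (E j) y) (V i y) (V j y) η
      - wedge₃ (VectorField.lieBracket ℝ (E i) (V j) y) (V i y) (E j y) η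
      - wedge₃ (VectorField.lieBracket ℝ (V i) (E j) y) (E i y) (V j y) η
      + wedge₃ (VectorField.lieBracket ℝ (V i) (V j) y) (E i y) (E j y) η)

/-- The trivector `(∧³ π♯) ψ` on `ℝⁿ`, where `ψ = ⅙ ∑ ψ_{klm} ε^k ∧ ε^l ∧ ε^m`. -/
def wedgeSharp₃ (p : (Model n →L[ℝ] ℝ) → Model n) (ψ : Model n [⋀^Fin 3]→L[ℝ] ℝ)
    (η : Fin 3 → (Model n →L[ℝ] ℝ)) : ℝ :=
  (1 / 6) * ∑ k, ∑ l, ∑ r, ψ ![e k, e l, e r] * wedge₃ (p (ε k)) (p (ε l)) (p (ε r)) η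

/-- `(π, ψ)` is a twisted Poisson structure on `M`: `π` is a smooth bivector field, `ψ` a smooth
closed `3`-form and `½ [π, π] = (∧³ π♯) ψ`. -/
structure IsTwistedPoisson (π : SharpField n M) (ψ : Form n M 3) : Prop where
  bivector : IsBivectorField π
  smooth : ψ.IsSmooth
  closed : ∀ m : M, ψ.d m = 0
  jacobi : ∀ (m : M) (η : Fin 3 → (Model n →L[ℝ] ℝ)),
    (1 / 2) * schouten (π.inChart m) (extChartAt (𝓡 n) m m) η =
      wedgeSharp₃ (π.inChart m (extChartAt (𝓡 n) m m)) (ψ.inChart m (extChartAt (𝓡 n) m m)) η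

/-! ### The modular class -/

/-- `X` is the vector field `X_{π,μ}`, the one such that
`⟨α, X⟩ μ = L_{π♯ α} μ - (i_π dα) μ` for all `1`-forms `α`. -/
def IsX (π : SharpField n M) (μ : VolumeField n M) (X : VectorField n M) : Prop :=
  ∀ α : CovectorField n M, α.toForm.IsSmooth → ∀ (m : M) (v : Fin n → Tan n m),
    α m (X m) * μ m v =
      lieDeriv (fun x => π x (α x)) μ m v - interiorBivector π α.toForm.d m * μ m v

/-- The vector `Y_{π,ψ}` at `m`, given by `⟨α, Y⟩ = ½ Tr (β ↦ ψ(π♯ α, π♯ β, ·))`; see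
`apply_Y`. It is written in the basis of `T_m M = ℝⁿ`. -/
def Y (π : SharpField n M) (ψ : Form n M 3) : VectorField n M := fun m =>
  (∑ i : Fin n, ((1 / 2 : ℝ) * LinearMap.trace ℝ (Cotan n m)
    (flat₃ (ψ m) (π m (ε i : Model n →L[ℝ] ℝ)) ∘ₗ π m)) • (e i : Model n) : Model n)

theorem apply_Y (π : SharpField n M) (ψ : Form n M 3) (m : M) (α : Cotan n m) :
    α (Y π ψ m) = (1 / 2) * LinearMap.trace ℝ (Cotan n m) (flat₃ (ψ m) (π m α) ∘ₗ π m) := by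
  have hflat (a : ℝ) (u v : Tan n m) :
      flat₃ (ψ m) (a • u + v) = a • flat₃ (ψ m) u + flat₃ (ψ m) v := by
    ext y z
    have h (u : Tan n m) : (![u, y, z] : Fin 3 → Tan n m) = Function.update ![0, y, z] 0 u := by
      ext i; fin_cases i <;> rfl
    simp only [LinearMap.add_apply, LinearMap.smul_apply, add_apply, smul_apply, flat₃_apply]
    rw [h (a • u + v), h u, h v, (ψ m).map_update_add, (ψ m).map_update_smul]
  let T : Cotan n m →ₗ[ℝ] ℝ :=
    { toFun := fun β =>
        (1 / 2) * LinearMap.trace ℝ (Cotan n m) (flat₃ (ψ m) (π m β) ∘ₗ π m)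
      map_add' := fun β γ => by
        have h := hflat 1 (π m β) (π m γ)
        rw [one_smul, one_smul] at h
        rw [map_add, h, LinearMap.add_comp, map_add, mul_add]
      map_smul' := fun a β => by
        have h := hflat a (π m β) 0
        have h00 : flat₃ (ψ m) 0 = 0 := by
          ext y z
          rw [flat₃_apply]
          exact (ψ m).map_coord_zero 0 rfl
        rw [add_zero, h00, add_zero] at h
        rw [map_smul, h, LinearMap.smul_comp, map_smul, RingHom.id_apply, smul_eq_mul,
          smul_eq_mul]
        ring }
  have hα : (α : Model n →L[ℝ] ℝ) = ∑ i, (α : Model n →L[ℝ] ℝ) (e i) • ε i := covector_eq_sum _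
  have h1 : α (Y π ψ m) = ∑ i, T (ε i : Model n →L[ℝ] ℝ) * (α : Model n →L[ℝ] ℝ) (e i) := by
    refine (map_sum (show Model n →L[ℝ] ℝ from α) _ _).trans (Finset.sum_congr rfl fun i _ => ?_)
    exact (show Model n →L[ℝ] ℝ from α).map_smul _ _
  have h2 : T α = ∑ i, T (ε i : Model n →L[ℝ] ℝ) * (α : Model n →L[ℝ] ℝ) (e i) := by
    have h3 : T α = T (∑ i, (α : Model n →L[ℝ] ℝ) (e i) • (ε i : Model n →L[ℝ] ℝ) :
      Model n →L[ℝ] ℝ) := congrArg T hα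
    rw [h3]
    refine (map_sum T _ _).trans (Finset.sum_congr rfl fun i _ => ?_)
    refine (T.map_smul _ _).trans ?_
    rw [smul_eq_mul, mul_comm]
  exact h1.trans h2.symm

/-- The modular vector field `Z = X_{π,μ} + Y_{π,ψ}`. -/
def IsModularField (π : SharpField n M) (ψ : Form n M 3) (μ : VolumeField n M)
    (Z : VectorField n M) : Prop :=
  ∃ X : VectorField n M, IsX π μ X ∧ Z = fun m => X m + Y π ψ m

/-- The hamiltonian vector field `H_g = π♯ (dg)`. -/
def hamiltonian (π : SharpField n M) (g : M → ℝ) : VectorField n M := fun m =>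
  π m (mfderiv (𝓡 n) 𝓘(ℝ, ℝ) g m : Tan n m →L[ℝ] ℝ)

/-- `X` is in the modular class of `(TM, π, ψ)`, i.e. cohomologous to a modular vector field; the
coboundary of a function `g` is `[π, g] = -H_g`. -/
def InModularClass (π : SharpField n M) (ψ : Form n M 3) (X : VectorField n M) : Prop :=
  ∃ (μ : VolumeField n M) (Z : VectorField n M) (g : M → ℝ),
    IsVolume μ ∧ IsModularField π ψ μ Z ∧ ContMDiff (𝓡 n) 𝓘(ℝ, ℝ) ∞ g ∧
      ∀ m, X m = Z m - hamiltonian π g m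

/-! ### Gauge transformations -/

/-- The endomorphism `σ_B : α ↦ α + i_{π♯ α} B` of `T*_m M`. -/
def gaugeEnd (π : SharpField n M) (B : Form n M 2) (m : M) : Module.End ℝ (Cotan n m) :=
  LinearMap.id + flat (B m) ∘ₗ π m

/-- The map `(π')♯ = π♯ ∘ (Id + B♭ ∘ π♯)⁻¹` of the gauge transformed bivector `π'`. -/
def gaugeBivector (π : SharpField n M) (B : Form n M 2) : SharpField n M := fun m =>
  π m ∘ₗ Ring.inverse (gaugeEnd π B m)

/-- The gauge transformed `3`-form `ψ - dB`. -/
def gaugeForm (ψ : Form n M 3) (B : Form n M 2) : Form n M 3 := fun m =>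
  ψ m - (B.d m : Tan n m [⋀^Fin 3]→L[ℝ] ℝ)

end Manifold

end TwistedPoisson

end

open scoped Manifold ContDiff Topology

noncomputable section

namespace TwistedPoisson

open Matrix

/-! The engine is the relation `σ_Bᵀ Z' = Z + H_f` with `f = ½ log |det σ_B|`. Here `Z` and `Z'` are
the modular fields of `(π, ψ)` and of its gauge transform for the same volume `μ`, and `σ_Bᵀ X = X +
π♯ i_X B` is the transpose of `σ_B`. Since also `σ_Bᵀ (π'♯ dg) = π♯ dg`, the map `σ_Bᵀ` carries `Z'
- H'_g` to `Z - H_{g - f}`, and it matches the two modular classes.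

To obtain the relation, pair it with a 1-form `α`. Because `π'♯ σ_B α = π♯ α`, the Lie derivative of
`μ` is the same for `(π', σ_B α)` as for `(π, α)`, so `μ` drops out. What remains compares `i_{π'}
d(σ_B α)` with `i_π dα`, and `Y'` with `Y` (`interiorBivector_gauge`). All derivatives at `m` are
taken in the chart at `m`, so no change of charts is needed.

In coordinates the derivatives of `α` cancel because `P' S = P`, where `P`, `P'`, `S` are the
matrices of `π♯`, `π'♯`, `σ_B`. The rest is the identity `trace_gauge_identity`. With `b` the matrix
of `B♭`, the matrix `N = S⁻¹ b` is skew and `P' = P - P N P`. Hence the change in the trace against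
`ψ` involves only `P Ψ P`, which the twisted Jacobi identity contracted with `α` (`contract_jacobi`)
turns into derivatives of `P`. The `dB` in `ψ - dB` absorbs the derivatives of `B` coming from
`d(σ_B α)`. What survives is `-½ tr (S⁻¹ D_v S)` with `v = π♯ α`. By Jacobi's formula for
determinants this is `-df(π♯ α)`, which equals `⟨α, H_f⟩` by skewness. -/

/-! ### Matrix calculus and the trace identity. -/

/-- Jacobi's formula for the derivative of a determinant. -/
theorem fderiv_det {n : ℕ} {E : Type*} [NormedAddCommGroup E] [NormedSpace ℝ E]
    {A : E → Matrix (Fin n) (Fin n) ℝ} {y : E}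
    (hA : ∀ i j, DifferentiableAt ℝ (fun z => A z i j) y) (w : E) :
    fderiv ℝ (fun z => (A z).det) y w =
      trace (adjugate (A y) * Matrix.of fun i j => fderiv ℝ (fun z => A z i j) y w) := by
  set A' : Matrix (Fin n) (Fin n) ℝ := Matrix.of fun i j => fderiv ℝ (fun z => A z i j) y w
  have h1 : HasFDerivAt (fun z => (A z).det)
      (∑ σ : Equiv.Perm (Fin n), ((Equiv.Perm.sign σ : ℤ) : ℝ) •
        ∑ k, (∏ j ∈ Finset.univ.erase k, A y (σ j) j) • fderiv ℝ (fun z => A z (σ k) k) y) y := by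
    simp only [det_apply']
    refine HasFDerivAt.fun_sum fun σ _ => ?_
    refine HasFDerivAt.const_mul ?_ _
    exact HasFDerivAt.finsetProd fun i _ => (hA _ _).hasFDerivAt
  -- Cramer's rule: a diagonal entry of `adj(A) A'` is the determinant of `A` with one column
  -- differentiated.
  have h2 (k : Fin n) : (adjugate (A y) * A') k k = ((A y).updateCol k fun i => A' i k).det := by
    rw [← cramer_apply, cramer_eq_adjugate_mulVec]
    rfl
  rw [h1.fderiv]
  simp only [trace, diag, h2, det_apply', _root_.sum_apply, _root_.smul_apply, smul_eq_mul]
  rw [Finset.sum_comm]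
  simp only [Finset.mul_sum]
  rw [Finset.sum_comm]
  conv_rhs => rw [Finset.sum_comm]
  refine Finset.sum_congr rfl fun k _ => Finset.sum_congr rfl fun σ _ => ?_
  rw [← Finset.mul_prod_erase _ _ (Finset.mem_univ k), updateCol_self]
  rw [mul_comm (A' _ _)]
  congr 2
  refine Finset.prod_congr rfl fun j hj => ?_
  rw [updateCol_ne (Finset.ne_of_mem_erase hj)]

theorem contDiffOn_det {n : ℕ} {E : Type*} [NormedAddCommGroup E] [NormedSpace ℝ E]
    {A : E → Matrix (Fin n) (Fin n) ℝ} {s : Set E}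
    (hA : ∀ i j, ContDiffOn ℝ ∞ (fun z => A z i j) s) :
    ContDiffOn ℝ ∞ (fun z => (A z).det) s := by
  simp only [det_apply']
  exact ContDiffOn.sum fun σ _ => contDiffOn_const.mul (contDiffOn_prod fun i _ => hA _ _)

theorem contDiffOn_inv {n : ℕ} {E : Type*} [NormedAddCommGroup E] [NormedSpace ℝ E]
    {A : E → Matrix (Fin n) (Fin n) ℝ} {s : Set E}
    (hA : ∀ i j, ContDiffOn ℝ ∞ (fun z => A z i j) s) (hdet : ∀ y ∈ s, (A y).det ≠ 0)
    (i j : Fin n) :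
    ContDiffOn ℝ ∞ (fun z => (A z)⁻¹ i j) s := by
  simp only [inv_def, Ring.inverse_eq_inv', Matrix.smul_apply, smul_eq_mul, adjugate_apply]
  refine ((contDiffOn_det hA).inv hdet).mul (contDiffOn_det fun k l => ?_)
  by_cases h : k = j
  · subst h
    simpa using contDiffOn_const
  · simpa [updateRow_ne h] using hA k l

theorem contDiffOn_mul {n : ℕ} {E : Type*} [NormedAddCommGroup E] [NormedSpace ℝ E]
    {A A' : E → Matrix (Fin n) (Fin n) ℝ} {s : Set E}
    (hA : ∀ i j, ContDiffOn ℝ ∞ (fun z => A z i j) s)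
    (hA' : ∀ i j, ContDiffOn ℝ ∞ (fun z => A' z i j) s) (i j : Fin n) :
    ContDiffOn ℝ ∞ (fun z => (A z * A' z) i j) s := by
  simp only [mul_apply]
  exact ContDiffOn.sum fun k _ => (hA _ _).mul (hA' _ _)

/-- Gauge transforms of skew-symmetric maps are skew-symmetric. -/
theorem gauge_transpose {n : ℕ} {P b S P' : Matrix (Fin n) (Fin n) ℝ}
    (hP : Pᵀ = -P) (hb : bᵀ = -b) (hS : S = 1 + b * P) (hdet : IsUnit S.det) (hP' : P' * S = P) :
    P'ᵀ = -P' := by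
  have hSt : Sᵀ = 1 + P * b := by
    rw [hS, transpose_add, transpose_mul, hP, hb]; simp
  -- Both sides are `P + P b P`; the relation moves the inverse across `P`, from `P S⁻¹` to `Sᵀ⁻¹
  -- P`.
  have e2 : Sᵀ * P = P * S := by rw [hSt, hS]; noncomm_ring
  have hdet' : IsUnit Sᵀ.det := by rwa [det_transpose]
  have h : Sᵀ * P'ᵀ = Sᵀ * -P' := by
    have e1 : P' = P * S⁻¹ := by
      rw [← hP', Matrix.mul_assoc, mul_nonsing_inv _ hdet, Matrix.mul_one]
    rw [← transpose_mul, hP', hP, Matrix.mul_neg, e1, ← Matrix.mul_assoc, e2, Matrix.mul_assoc,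
      mul_nonsing_inv _ hdet, Matrix.mul_one]
  have := congrArg (Sᵀ⁻¹ * ·) h
  simpa [← Matrix.mul_assoc, nonsing_inv_mul _ hdet'] using this

/-- The pointwise identity behind the invariance of the modular class, in coordinates: `P`, `b`,
`S` are the matrices of `π♯`, `B♭`, `σ_B`, and `A`, `R` those of `D_v π♯`, `ξ ↦ (D_{π♯ ξ} π♯) α`,
where `v = π♯ α`. -/
theorem trace_gauge_identity {n : ℕ} {P b S P' A R U C D Ψ : Matrix (Fin n) (Fin n) ℝ}
    (hP : Pᵀ = -P) (hb : bᵀ = -b) (hS : S = 1 + b * P) (hdet : IsUnit S.det) (hP' : P' * S = P)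
    (hR : R = U * P) (hJ : R - Rᵀ - A = -(P * Ψ * P)) :
    (1 / 2) * trace ((Ψ - (D - C + Cᵀ)) * P') - (1 / 2) * trace (Ψ * P)
        - trace ((C + b * U) * P')
      = -(1 / 2) * trace (S⁻¹ * (D * P + b * A)) := by
  have hSt : Sᵀ = 1 + P * b := by
    rw [hS, transpose_add, transpose_mul, hP, hb]; simp
  have hdet' : IsUnit Sᵀ.det := by rwa [det_transpose]
  have e1 : P' = P * S⁻¹ := by rw [← hP', Matrix.mul_assoc, mul_nonsing_inv _ hdet, Matrix.mul_one]
  have e3 : b * Sᵀ = S * b := by rw [hSt, hS]; noncomm_ring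
  have e4 : P'ᵀ = -P' := gauge_transpose hP hb hS hdet hP'
  -- `N` measures the change of the bivector. It is skew because `b Sᵀ = S b`, and `S⁻¹ S = 1` reads
  -- `S⁻¹ = 1 - N P`.
  set N := S⁻¹ * b with hN
  have e5 : Nᵀ = -N := by
    have h : N = b * Sᵀ⁻¹ := by
      have := congrArg (fun Z => S⁻¹ * Z * Sᵀ⁻¹) e3
      simp only [Matrix.mul_assoc, mul_nonsing_inv _ hdet', Matrix.mul_one] at this
      rw [hN, this, ← Matrix.mul_assoc, nonsing_inv_mul _ hdet, Matrix.one_mul]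
    rw [hN, transpose_mul, hb, transpose_nonsing_inv, Matrix.neg_mul, ← h]
  have e6 : P' = P - P * N * P := by
    have h : S⁻¹ = 1 - N * P := by
      have : S⁻¹ * S = 1 := nonsing_inv_mul _ hdet
      rw [hS, Matrix.mul_add, Matrix.mul_one, ← hS, ← Matrix.mul_assoc] at this
      rw [hN, ← this]; abel
    rw [e1, h]; noncomm_ring
  have t1 : trace (Cᵀ * P') = -trace (C * P') := by
    rw [← trace_transpose, transpose_mul, e4, transpose_transpose, Matrix.neg_mul, trace_neg,
      trace_mul_comm]
  have t2 : trace (b * U * P') = trace (N * R) := by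
    rw [hR, hN, e1, ← Matrix.mul_assoc, trace_mul_comm _ S⁻¹]
    simp only [Matrix.mul_assoc]
  have t3 : trace (S⁻¹ * (D * P + b * A)) = trace (D * P') + trace (N * A) := by
    rw [Matrix.mul_add, trace_add, hN, e1, ← Matrix.mul_assoc D, trace_mul_comm _ S⁻¹,
      Matrix.mul_assoc S⁻¹ b]
  have t4 : trace (N * Rᵀ) = -trace (N * R) := by
    rw [← trace_transpose, transpose_mul, e5, transpose_transpose, Matrix.mul_neg, trace_neg,
      trace_mul_comm]
  -- The only use of the Jacobi identity: `P' - P = -P N P` brings in `P Ψ P`, and skewness of `N`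
  -- merges the `R` and `Rᵀ` terms.
  have t5 : trace (Ψ * P') = trace (Ψ * P) + (2 * trace (N * R) - trace (N * A)) := by
    have h : trace (Ψ * (P * N * P)) = trace (N * (P * Ψ * P)) := by
      rw [Matrix.mul_assoc P, ← Matrix.mul_assoc Ψ, trace_mul_comm]
      simp only [Matrix.mul_assoc]
    rw [e6, Matrix.mul_sub, trace_sub, h, ← neg_neg (P * Ψ * P), ← hJ]
    simp only [Matrix.mul_sub, Matrix.mul_neg, trace_sub, trace_neg, t4]
    ring
  rw [t3]
  simp only [Matrix.sub_mul, Matrix.add_mul, trace_sub, trace_add, t1, t2, t5]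
  ring

/-! ### Linear algebra of `π♯`, `B♭` and `σ_B` in a frame. -/

section Frame

variable {n : ℕ} {M : Type*} [TopologicalSpace M] [ChartedSpace (Model n) M]

theorem vector_eq_sum {n : ℕ} (v : Model n) : v = ∑ i, v i • e i := by
  ext j
  simp [e, Pi.single_apply]

theorem ε_apply {n : ℕ} (i : Fin n) (v : Model n) : ε i v = v i := rfl

theorem e_apply {n : ℕ} (i j : Fin n) : (e i : Model n) j = if j = i then 1 else 0 := by
  simp [e]

/-- The coordinates of a covector in a frame. -/
def covCoord {x : M} (L : Tan n x ≃L[ℝ] Model n) (α : Cotan n x) (k : Fin n) : ℝ :=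
  α (L.symm (e k))

/-- The covectors of the dual frame. -/
def coframe {x : M} (L : Tan n x ≃L[ℝ] Model n) (k : Fin n) : Cotan n x :=
  (ε k : Model n →L[ℝ] ℝ) ∘L (L : Tan n x →L[ℝ] Model n)

theorem tangent_eq_sum {x : M} (L : Tan n x ≃L[ℝ] Model n) (w : Tan n x) :
    w = ∑ i, (L w) i • L.symm (e i) := by
  apply L.injective
  rw [map_sum]
  simp only [map_smul, ContinuousLinearEquiv.apply_symm_apply]
  exact vector_eq_sum _

theorem covCoord_coframe {x : M} (L : Tan n x ≃L[ℝ] Model n) (i k : Fin n) :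
    covCoord L (coframe L i) k = if i = k then 1 else 0 := by
  simp [covCoord, coframe, ε_apply, e_apply]

theorem apply_eq_sum {x : M} (L : Tan n x ≃L[ℝ] Model n) (α : Cotan n x) (w : Tan n x) :
    α w = ∑ k, covCoord L α k * (L w) k := by
  conv_lhs => rw [tangent_eq_sum L w, map_sum]
  simp [covCoord, mul_comm]

theorem eq_sum_coframe {x : M} (L : Tan n x ≃L[ℝ] Model n) (α : Cotan n x) :
    α = ∑ k, covCoord L α k • coframe L k := by
  ext w
  rw [apply_eq_sum L α w, _root_.sum_apply]
  rfl

/-- The basis of the cotangent space that is dual to a frame. -/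
def coframeBasis {x : M} (L : Tan n x ≃L[ℝ] Model n) : Module.Basis (Fin n) ℝ (Cotan n x) :=
  Module.Basis.ofEquivFun
    { toFun := covCoord L
      map_add' := fun _ _ => rfl
      map_smul' := fun _ _ => rfl
      invFun := fun a => ∑ k, a k • coframe L k
      left_inv := fun α => (eq_sum_coframe L α).symm
      right_inv := fun a => by
        ext i
        have h : covCoord L (∑ k, a k • coframe L k) i
            = ∑ k, a k * covCoord L (coframe L k) i := by
          simp [covCoord, _root_.sum_apply]
        rw [h]
        simp [covCoord_coframe] }

theorem coframeBasis_apply {x : M} (L : Tan n x ≃L[ℝ] Model n) (k : Fin n) :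
    coframeBasis L k = coframe L k := by
  rw [coframeBasis, Module.Basis.coe_ofEquivFun]
  simp [Pi.single_apply]

theorem coframeBasis_repr {x : M} (L : Tan n x ≃L[ℝ] Model n) (α : Cotan n x) (k : Fin n) :
    (coframeBasis L).repr α k = covCoord L α k := rfl

/-- The matrix of a map `T*M → TM` in a frame. -/
def sharpMat {x : M} (L : Tan n x ≃L[ℝ] Model n) (p : Cotan n x →ₗ[ℝ] Tan n x) :
    Matrix (Fin n) (Fin n) ℝ :=
  Matrix.of fun i j => (L (p (coframe L j))) i

/-- The matrix of a map `TM → T*M` in a frame. -/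
def flatMat {x : M} (L : Tan n x ≃L[ℝ] Model n) (F : Tan n x →ₗ[ℝ] Cotan n x) :
    Matrix (Fin n) (Fin n) ℝ :=
  Matrix.of fun k l => F (L.symm (e l)) (L.symm (e k))

theorem sharpMat_mulVec {x : M} (L : Tan n x ≃L[ℝ] Model n) (p : Cotan n x →ₗ[ℝ] Tan n x)
    (α : Cotan n x) (i : Fin n) : (L (p α)) i = (sharpMat L p *ᵥ covCoord L α) i := by
  conv_lhs => rw [eq_sum_coframe L α]
  simp [mulVec, dotProduct, sharpMat, mul_comm]

theorem flatMat_mulVec {x : M} (L : Tan n x ≃L[ℝ] Model n) (F : Tan n x →ₗ[ℝ] Cotan n x)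
    (w : Tan n x) (k : Fin n) : covCoord L (F w) k = (flatMat L F *ᵥ (L w).ofLp) k := by
  conv_lhs => rw [tangent_eq_sum L w]
  simp [mulVec, dotProduct, flatMat, covCoord, mul_comm, _root_.sum_apply]

theorem toMatrix_flat_sharp {x : M} (L : Tan n x ≃L[ℝ] Model n) (F : Tan n x →ₗ[ℝ] Cotan n x)
    (p : Cotan n x →ₗ[ℝ] Tan n x) :
    LinearMap.toMatrix (coframeBasis L) (coframeBasis L) (F ∘ₗ p)
      = flatMat L F * sharpMat L p := by
  ext i j
  rw [LinearMap.toMatrix_apply, coframeBasis_repr, coframeBasis_apply, LinearMap.comp_apply,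
    flatMat_mulVec]
  rfl

theorem trace_flat_sharp {x : M} (L : Tan n x ≃L[ℝ] Model n) (F : Tan n x →ₗ[ℝ] Cotan n x)
    (p : Cotan n x →ₗ[ℝ] Tan n x) :
    LinearMap.trace ℝ (Cotan n x) (F ∘ₗ p) = Matrix.trace (flatMat L F * sharpMat L p) := by
  rw [LinearMap.trace_eq_matrix_trace ℝ (coframeBasis L), toMatrix_flat_sharp]

theorem covCoord_gauge {x : M} (L : Tan n x ≃L[ℝ] Model n) (π : SharpField n M) (B : Form n M 2)
    (α : Cotan n x) :
    covCoord L (gaugeEnd π B x α)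
      = (1 + flatMat L (flat (B x)) * sharpMat L (π x)) *ᵥ covCoord L α := by
  have h : covCoord L (gaugeEnd π B x α) = covCoord L α + covCoord L (flat (B x) (π x α)) := rfl
  ext k
  rw [h, Pi.add_apply, flatMat_mulVec, add_mulVec, one_mulVec, ← mulVec_mulVec, Pi.add_apply]
  congr 3
  ext i
  exact sharpMat_mulVec L _ _ _

theorem det_gauge {x : M} (L : Tan n x ≃L[ℝ] Model n) (π : SharpField n M) (B : Form n M 2) :
    LinearMap.det (gaugeEnd π B x)
      = (1 + flatMat L (flat (B x)) * sharpMat L (π x)).det := by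
  rw [← LinearMap.det_toMatrix (coframeBasis L), gaugeEnd, map_add, toMatrix_flat_sharp,
    LinearMap.toMatrix_id]

theorem sharpMat_transpose {π : SharpField n M} (hπ : IsBivectorField π) {x : M}
    (L : Tan n x ≃L[ℝ] Model n) : (sharpMat L (π x))ᵀ = -sharpMat L (π x) := by
  ext i j
  exact hπ.skew x (coframe L i) (coframe L j)

theorem alternating_two_swap {x : M} (τ : Tan n x [⋀^Fin 2]→L[ℝ] ℝ) (u v : Tan n x) :
    τ ![u, v] = -τ ![v, u] := by
  have h := τ.toAlternatingMap.map_swap ![u, v] (i := 0) (j := 1) (by decide)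
  have h' : (![u, v] ∘ ⇑(Equiv.swap (0 : Fin 2) 1) : Fin 2 → Tan n x) = ![v, u] := by
    ext i; fin_cases i <;> rfl
  rw [h'] at h
  have h2 : τ ![v, u] = -τ ![u, v] := h
  rw [h2, neg_neg]

theorem flatMat_transpose {x : M} (τ : Tan n x [⋀^Fin 2]→L[ℝ] ℝ)
    (L : Tan n x ≃L[ℝ] Model n) : (flatMat L (flat τ))ᵀ = -flatMat L (flat τ) := by
  ext i j
  simp only [transpose_apply, flatMat, of_apply, Matrix.neg_apply, flat_apply]
  exact alternating_two_swap _ _ _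

/-- This is what removes the Lie derivative from the comparison. `Ring.inverse` is `0` off the
units, so invertibility of `σ_B` is essential. -/
theorem gaugeBivector_gaugeEnd {π : SharpField n M} {B : Form n M 2} {x : M}
    (hσ : IsUnit (gaugeEnd π B x)) (α : Cotan n x) :
    gaugeBivector π B x (gaugeEnd π B x α) = π x α := by
  have h : Ring.inverse (gaugeEnd π B x) * gaugeEnd π B x = 1 := Ring.inverse_mul_cancel _ hσ
  have h2 := LinearMap.congr_fun h α
  exact congrArg (π x) h2

theorem sharpMat_gauge {π : SharpField n M} {B : Form n M 2} {x : M}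
    (hσ : IsUnit (gaugeEnd π B x)) (L : Tan n x ≃L[ℝ] Model n) :
    sharpMat L (gaugeBivector π B x) * (1 + flatMat L (flat (B x)) * sharpMat L (π x))
      = sharpMat L (π x) := by
  ext i j
  have h := gaugeBivector_gaugeEnd hσ (coframe L j)
  have h2 := sharpMat_mulVec L (gaugeBivector π B x) (gaugeEnd π B x (coframe L j)) i
  rw [h, covCoord_gauge, mulVec_mulVec] at h2
  have h3 : covCoord L (coframe L j) = Pi.single j 1 := by
    ext k
    rw [covCoord_coframe, Pi.single_apply]
    simp [eq_comm]
  rw [h3, mulVec_single_one] at h2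
  exact h2.symm

/-- Gauge transformed bivector fields and the transpose of `σ_B`. -/
theorem gaugeBivector_add {π : SharpField n M} {B : Form n M 2} {x : M}
    (hσ : IsUnit (gaugeEnd π B x)) (α : Cotan n x) :
    gaugeBivector π B x α + π x (flat (B x) (gaugeBivector π B x α)) = π x α := by
  have h : gaugeEnd π B x * Ring.inverse (gaugeEnd π B x) = 1 := Ring.mul_inverse_cancel _ hσ
  have h2 : Ring.inverse (gaugeEnd π B x) α
      + flat (B x) (π x (Ring.inverse (gaugeEnd π B x) α)) = α := LinearMap.congr_fun h α
  have h3 := congrArg (π x) h2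
  rwa [map_add] at h3

/-- The transpose of `σ_B` is `X ↦ X + π♯ i_X B`. -/
theorem gaugeEnd_apply_apply {π : SharpField n M} (hπ : IsBivectorField π) (B : Form n M 2) {x : M}
    (α : Cotan n x) (w : Tan n x) :
    gaugeEnd π B x α w = α (w + π x (flat (B x) w)) := by
  have h : gaugeEnd π B x α w = α w + flat (B x) (π x α) w := rfl
  rw [h, map_add, hπ.skew, flat_apply, flat_apply, alternating_two_swap]

end Frame

/-! ### Chart expressions and smoothness. -/

section Chart

variable {n : ℕ} {M : Type*} [TopologicalSpace M] [ChartedSpace (Model n) M]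

/-- The matrix of `π♯` in a chart. -/
def chartSharp (π : SharpField n M) (c : M) (y : Model n) : Matrix (Fin n) (Fin n) ℝ :=
  Matrix.of fun i j => (π.inChart c y (ε j)) i

/-- The matrix of `B♭` in a chart. -/
def chartFlat (B : Form n M 2) (c : M) (y : Model n) : Matrix (Fin n) (Fin n) ℝ :=
  Matrix.of fun k l => B.inChart c y ![e l, e k]

/-- The components of a `1`-form in a chart. -/
def chartCoord (α : CovectorField n M) (c : M) (y : Model n) (k : Fin n) : ℝ :=
  α.toForm.inChart c y ![e k]

/-- The matrix of `σ_B` in a chart. -/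
def chartGauge (π : SharpField n M) (B : Form n M 2) (c : M) (y : Model n) :
    Matrix (Fin n) (Fin n) ℝ :=
  1 + chartFlat B c y * chartSharp π c y

/-- `L` is the frame at `x` given by the chart at `c`, with `y` the coordinates of `x`. -/
structure IsChartFrame (c : M) (y : Model n) (x : M) (L : Tan n x ≃L[ℝ] Model n) : Prop where
  mfderiv_eq : ∀ w : Tan n x, mfderiv (𝓡 n) 𝓘(ℝ, Model n) (extChartAt (𝓡 n) c) x w = L w
  form : ∀ (k : ℕ) (τ : Form n M k) (v : Fin k → Model n),
    τ.inChart c y v = τ x (fun i => L.symm (v i))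
  sharp : ∀ (π : SharpField n M) (ξ : Model n →L[ℝ] ℝ),
    π.inChart c y ξ = L (π x (ξ ∘L (L : Tan n x →L[ℝ] Model n)))

/-- The point `x` is tied to `y` by an equation instead of being `φ⁻¹ y` itself. For `y = φ m` the
frame then lives on `T_m M`, where `φ⁻¹ (φ m) = m` is not definitional. -/
theorem exists_isChartFrame [IsManifold (𝓡 n) ∞ M] {c : M} {y : Model n}
    (hy : y ∈ (extChartAt (𝓡 n) c).target) {x : M} (hx : (extChartAt (𝓡 n) c).symm y = x) :
    ∃ L : Tan n x ≃L[ℝ] Model n, IsChartFrame c y x L := by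
  subst hx
  have : IsManifold (𝓡 n) 1 M := IsManifold.of_le (n := ∞) (by simp)
  obtain ⟨L, hL⟩ : ∃ L : Tan n ((extChartAt (𝓡 n) c).symm y) ≃L[ℝ] Model n,
      (L : Tan n ((extChartAt (𝓡 n) c).symm y) →L[ℝ] Model n) = dChart c y :=
    isInvertible_mfderiv_extChartAt (I := 𝓡 n) ((extChartAt (𝓡 n) c).map_target hy)
  have hL' : dChart c y = L := hL.symm
  have hsymm (u : Model n) : dChartSymm c y u = L.symm u := by
    apply L.injective
    have h := mfderiv_extChartAt_comp_mfderivWithin_extChartAt_symm (I := 𝓡 n) hy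
    rw [ModelWithCorners.range_eq_univ, mfderivWithin_univ] at h
    have h2 : dChart c y (dChartSymm c y u) = u := DFunLike.congr_fun h u
    rw [hL'] at h2
    rw [ContinuousLinearEquiv.apply_symm_apply]
    exact h2
  refine ⟨L, fun w => (DFunLike.congr_fun hL w).symm, fun k τ v => ?_, fun π ξ => ?_⟩
  · have h : τ.inChart c y v
      = τ ((extChartAt (𝓡 n) c).symm y) (fun i => dChartSymm c y (v i)) := rfl
    rw [h]
    simp only [hsymm]
  · rw [SharpField.inChart, hL']
    rfl

namespace IsChartFrame

variable {c x : M} {y : Model n} {L : Tan n x ≃L[ℝ] Model n}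

theorem chartSharp (h : IsChartFrame c y x L) (π : SharpField n M) :
    chartSharp π c y = sharpMat L (π x) := by
  ext i j
  exact congrArg (fun v : Model n => v i) (h.sharp π (ε j))

theorem chartFlat (h : IsChartFrame c y x L) (B : Form n M 2) :
    chartFlat B c y = flatMat L (flat (B x)) := by
  ext k l
  simp only [TwistedPoisson.chartFlat, flatMat, of_apply, h.form, flat_apply]
  congr 1
  ext i; fin_cases i <;> rfl

theorem chartCoord (h : IsChartFrame c y x L) (α : CovectorField n M) :
    chartCoord α c y = covCoord L (α x) := by
  ext k
  rw [TwistedPoisson.chartCoord, h.form]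
  rfl

theorem chartGauge (h : IsChartFrame c y x L) (π : SharpField n M) (B : Form n M 2) :
    chartGauge π B c y = 1 + flatMat L (flat (B x)) * sharpMat L (π x) := by
  rw [TwistedPoisson.chartGauge, h.chartSharp, h.chartFlat]

end IsChartFrame

theorem contDiffOn_chartSharp {π : SharpField n M} (hπ : IsBivectorField π) (c : M) (i j : Fin n) :
    ContDiffOn ℝ ∞ (fun y => chartSharp π c y i j) (extChartAt (𝓡 n) c).target :=
  (ε i : Model n →L[ℝ] ℝ).contDiff.comp_contDiffOn (hπ.smooth c (ε j))

theorem contDiffOn_form_apply {k : ℕ} {τ : Form n M k} (hτ : τ.IsSmooth) (c : M)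
    (v : Fin k → Model n) :
    ContDiffOn ℝ ∞ (fun y => τ.inChart c y v) (extChartAt (𝓡 n) c).target :=
  (ContinuousAlternatingMap.apply ℝ (Model n) ℝ v).contDiff.comp_contDiffOn (hτ c)

theorem contDiffOn_chartGauge {π : SharpField n M} (hπ : IsBivectorField π) {B : Form n M 2}
    (hB : B.IsSmooth) (c : M) (i j : Fin n) :
    ContDiffOn ℝ ∞ (fun y => chartGauge π B c y i j) (extChartAt (𝓡 n) c).target := by
  have h := contDiffOn_mul (fun i j => contDiffOn_form_apply hB c ![e j, e i])
    (contDiffOn_chartSharp hπ c) i j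
  exact contDiffOn_const.add h

variable [IsManifold (𝓡 n) ∞ M]

theorem chartCoord_gauge (π : SharpField n M) (B : Form n M 2) (α : CovectorField n M) {c : M}
    {y : Model n} (hy : y ∈ (extChartAt (𝓡 n) c).target) :
    chartCoord (fun x => gaugeEnd π B x (α x)) c y = chartGauge π B c y *ᵥ chartCoord α c y := by
  obtain ⟨L, hL⟩ := exists_isChartFrame hy rfl
  rw [hL.chartCoord, hL.chartCoord, hL.chartGauge, covCoord_gauge]

theorem det_chartGauge (π : SharpField n M) (B : Form n M 2) {c : M}
    {y : Model n} (hy : y ∈ (extChartAt (𝓡 n) c).target) :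
    (chartGauge π B c y).det = LinearMap.det (gaugeEnd π B ((extChartAt (𝓡 n) c).symm y)) := by
  obtain ⟨L, hL⟩ := exists_isChartFrame hy rfl
  rw [hL.chartGauge, det_gauge L]

theorem isSmooth_toForm_iff (α : CovectorField n M) :
    α.toForm.IsSmooth ↔ ∀ (c : M) (k : Fin n),
      ContDiffOn ℝ ∞ (fun y => chartCoord α c y k) (extChartAt (𝓡 n) c).target := by
  refine ⟨fun h c k => contDiffOn_form_apply h c _, fun h c => ?_⟩
  have h1 : ContDiffOn ℝ ∞ (fun y => ∑ k, chartCoord α c y k •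
      ContinuousAlternatingMap.ofSubsingleton ℝ (Model n) ℝ (0 : Fin 1) (ε k))
      (extChartAt (𝓡 n) c).target :=
    ContDiffOn.sum fun k _ => (h c k).smul contDiffOn_const
  refine h1.congr fun y hy => ?_
  obtain ⟨L, hL⟩ := exists_isChartFrame hy rfl
  ext v
  rw [hL.form, hL.chartCoord]
  have h2 : α.toForm ((extChartAt (𝓡 n) c).symm y) (fun i => L.symm (v i))
    = α ((extChartAt (𝓡 n) c).symm y) (L.symm (v 0)) := rfl
  rw [h2, apply_eq_sum L, ContinuousLinearEquiv.apply_symm_apply,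
    ContinuousAlternatingMap.sum_apply]
  rfl

theorem isSmooth_gaugeEnd {π : SharpField n M} (hπ : IsBivectorField π) {B : Form n M 2}
    (hB : B.IsSmooth) {α : CovectorField n M} (hα : α.toForm.IsSmooth) :
    (CovectorField.toForm fun x => gaugeEnd π B x (α x)).IsSmooth := by
  rw [isSmooth_toForm_iff] at hα ⊢
  intro c k
  have h : ContDiffOn ℝ ∞ (fun y => ∑ j, chartGauge π B c y k j * chartCoord α c y j)
      (extChartAt (𝓡 n) c).target :=
    ContDiffOn.sum fun j _ => (contDiffOn_chartGauge hπ hB c k j).mul (hα c j)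
  refine h.congr fun y hy => ?_
  rw [chartCoord_gauge π B α hy]
  rfl

theorem isUnit_det_chartGauge {π : SharpField n M} {B : Form n M 2}
    (hσ : ∀ x, IsUnit (gaugeEnd π B x)) {c : M}
    {y : Model n} (hy : y ∈ (extChartAt (𝓡 n) c).target) : IsUnit (chartGauge π B c y).det := by
  rw [det_chartGauge π B hy]
  exact (hσ _).map LinearMap.det

/-- In a chart `α` is recovered by the inverse matrix of `σ_B`, smooth by the adjugate formula. So
`σ_B` permutes the smooth 1-forms, the test objects of `IsX`. -/
theorem isSmooth_of_gaugeEnd {π : SharpField n M} (hπ : IsBivectorField π) {B : Form n M 2}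
    (hB : B.IsSmooth) (hσ : ∀ x, IsUnit (gaugeEnd π B x)) {α : CovectorField n M}
    (hα : (CovectorField.toForm fun x => gaugeEnd π B x (α x)).IsSmooth) :
    α.toForm.IsSmooth := by
  rw [isSmooth_toForm_iff] at hα ⊢
  intro c k
  have h : ContDiffOn ℝ ∞ (fun y => ∑ j, (chartGauge π B c y)⁻¹ k j *
      chartCoord (fun x => gaugeEnd π B x (α x)) c y j) (extChartAt (𝓡 n) c).target :=
    ContDiffOn.sum fun j _ => (contDiffOn_inv (contDiffOn_chartGauge hπ hB c)
      (fun y hy => (isUnit_det_chartGauge hσ hy).ne_zero) k j).mul (hα c j)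
  refine h.congr fun y hy => ?_
  have h2 : (chartGauge π B c y)⁻¹ *ᵥ chartCoord (fun x => gaugeEnd π B x (α x)) c y
      = chartCoord α c y := by
    rw [chartCoord_gauge π B α hy, mulVec_mulVec, nonsing_inv_mul _ (isUnit_det_chartGauge hσ hy),
      one_mulVec]
  rw [← h2]
  rfl

end Chart

/-! ### The function `½ log |det σ_B|` and its differential. -/

section Potential

variable {n : ℕ} {M : Type*} [TopologicalSpace M] [ChartedSpace (Model n) M]

/-- The differential of a function, as a field of covectors. -/
def differential (g : M → ℝ) (m : M) : Cotan n m :=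
  mfderiv (𝓡 n) 𝓘(ℝ, ℝ) g m

/-- The function `½ log |det σ_B|`, by which modular fields change under gauge transformations. -/
def gaugePotential (π : SharpField n M) (B : Form n M 2) (x : M) : ℝ :=
  (1 / 2) * Real.log (LinearMap.det (gaugeEnd π B x))

variable [IsManifold (𝓡 n) ∞ M]

theorem gaugePotential_symm (π : SharpField n M) (B : Form n M 2) {c : M}
    {y : Model n} (hy : y ∈ (extChartAt (𝓡 n) c).target) :
    gaugePotential π B ((extChartAt (𝓡 n) c).symm y)
      = (1 / 2) * Real.log (chartGauge π B c y).det := by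
  rw [gaugePotential, det_chartGauge π B hy]

/-- `Real.log` is `log |·|`, smooth away from `0`, so the sign of `det σ_B` is irrelevant. -/
theorem contDiffOn_log_det_chartGauge {π : SharpField n M} (hπ : IsBivectorField π) {B : Form n M 2}
    (hB : B.IsSmooth) (hσ : ∀ x, IsUnit (gaugeEnd π B x)) (c : M) :
    ContDiffOn ℝ ∞ (fun y => (1 / 2) * Real.log (chartGauge π B c y).det)
      (extChartAt (𝓡 n) c).target :=
  contDiffOn_const.mul ((contDiffOn_det (contDiffOn_chartGauge hπ hB c)).log
    fun _ hy => (isUnit_det_chartGauge hσ hy).ne_zero)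

theorem contMDiff_gaugePotential {π : SharpField n M} (hπ : IsBivectorField π) {B : Form n M 2}
    (hB : B.IsSmooth) (hσ : ∀ x, IsUnit (gaugeEnd π B x)) :
    ContMDiff (𝓡 n) 𝓘(ℝ, ℝ) ∞ (gaugePotential π B) := by
  intro m
  have h1 : ContMDiffOn (𝓡 n) 𝓘(ℝ, ℝ) ∞
      ((fun y => (1 / 2) * Real.log (chartGauge π B m y).det) ∘ extChartAt (𝓡 n) m)
      (extChartAt (𝓡 n) m).source :=
    (contDiffOn_log_det_chartGauge hπ hB hσ m).contMDiffOn.comp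
      (by simpa using contMDiffOn_extChartAt (I := 𝓡 n) (n := ∞) (x := m))
      (extChartAt (𝓡 n) m).mapsTo
  have h2 : ContMDiffOn (𝓡 n) 𝓘(ℝ, ℝ) ∞ (gaugePotential π B) (extChartAt (𝓡 n) m).source :=
    h1.congr fun x hx => by
      have := gaugePotential_symm π B ((extChartAt (𝓡 n) m).map_source hx)
      rwa [(extChartAt (𝓡 n) m).left_inv hx] at this
  exact h2.contMDiffAt (extChartAt_source_mem_nhds m)

theorem differential_gaugePotential {π : SharpField n M} (hπ : IsBivectorField π) {B : Form n M 2}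
    (hB : B.IsSmooth) (hσ : ∀ x, IsUnit (gaugeEnd π B x)) (m : M) {L : Tan n m ≃L[ℝ] Model n}
    (hL : IsChartFrame m (extChartAt (𝓡 n) m m) m L) (w : Tan n m) :
    differential (gaugePotential π B) m w
      = (1 / 2) * trace ((chartGauge π B m (extChartAt (𝓡 n) m m))⁻¹ * Matrix.of fun i j =>
          fderiv ℝ (fun y => chartGauge π B m y i j) (extChartAt (𝓡 n) m m) (L w)) := by
  have : IsManifold (𝓡 n) 1 M := IsManifold.of_le (n := ∞) (by simp)
  set y₀ := extChartAt (𝓡 n) m m with hy₀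
  have hmem : y₀ ∈ (extChartAt (𝓡 n) m).target := mem_extChartAt_target m
  have hnhds : (extChartAt (𝓡 n) m).target ∈ 𝓝 y₀ := extChartAt_target_mem_nhds m
  set ℓ : Model n → ℝ := fun y => (1 / 2) * Real.log (chartGauge π B m y).det with hℓ
  have hdiff (i j : Fin n) : DifferentiableAt ℝ (fun y => chartGauge π B m y i j) y₀ :=
    ((contDiffOn_chartGauge hπ hB m i j).contDiffAt hnhds).differentiableAt (by simp)
  have hdet : (chartGauge π B m y₀).det ≠ 0 := (isUnit_det_chartGauge hσ hmem).ne_zero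
  have hdd : DifferentiableAt ℝ (fun y => (chartGauge π B m y).det) y₀ :=
    ((contDiffOn_det (contDiffOn_chartGauge hπ hB m)).contDiffAt hnhds).differentiableAt (by simp)
  have hlog : DifferentiableAt ℝ ℓ y₀ :=
    ((contDiffOn_log_det_chartGauge hπ hB hσ m).contDiffAt hnhds).differentiableAt (by simp)
  have h1 : gaugePotential π B =ᶠ[𝓝 m] ℓ ∘ extChartAt (𝓡 n) m := by
    filter_upwards [extChartAt_source_mem_nhds (I := 𝓡 n) m] with x hx
    have := gaugePotential_symm π B ((extChartAt (𝓡 n) m).map_source hx)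
    rwa [(extChartAt (𝓡 n) m).left_inv hx] at this
  have h2 : differential (gaugePotential π B) m w
      = fderiv ℝ ℓ y₀ (L w) := by
    have h3 := (hlog.hasFDerivAt.hasMFDerivAt.comp m (mdifferentiableAt_extChartAt (I := 𝓡 n)
      (mem_chart_source _ m)).hasMFDerivAt).congr_of_eventuallyEq h1
    rw [differential, h3.mfderiv, ← hL.mfderiv_eq w]
    rfl
  rw [h2, hℓ, fderiv_const_mul (hdd.log hdet), fderiv.log hdd hdet]
  rw [_root_.smul_apply, _root_.smul_apply, fderiv_det hdiff, inv_def, Ring.inverse_eq_inv',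
    Matrix.smul_mul, trace_smul]
  rfl

end Potential

/-! ### The twisted Jacobi identity in coordinates. -/

section Schouten

variable {n : ℕ}

/-- The entrywise derivative of a matrix valued function. -/
def matDeriv (A : Model n → Matrix (Fin n) (Fin n) ℝ) (y w : Model n) : Matrix (Fin n) (Fin n) ℝ :=
  Matrix.of fun i j => fderiv ℝ (fun z => A z i j) y w

theorem fderiv_eq_sum (f : Model n → ℝ) (y w : Model n) :
    fderiv ℝ f y w = ∑ l, w l * fderiv ℝ f y (e l) := by
  conv_lhs => rw [vector_eq_sum w, map_sum]
  simp

theorem matDeriv_eq_sum (A : Model n → Matrix (Fin n) (Fin n) ℝ) (y w : Model n) (i j : Fin n) :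
    matDeriv A y w i j = ∑ l, w l * matDeriv A y (e l) i j :=
  fderiv_eq_sum _ _ _

theorem wedge₃_ε (u v w : Model n) (a b c : Fin n) :
    wedge₃ u v w ![ε a, ε b, ε c] = u a * v b * w c - u a * w b * v c - v a * u b * w c
      + v a * w b * u c + w a * u b * v c - w a * v b * u c := by
  rw [wedge₃, det_fin_three]
  simp [ε_apply]

theorem fderiv_coord {V : Model n → Model n} {y : Model n} (hV : DifferentiableAt ℝ V y)
    (w : Model n) (k : Fin n) : (fderiv ℝ V y w) k = fderiv ℝ (fun z => V z k) y w := by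
  have h := (((ε k : Model n →L[ℝ] ℝ).hasFDerivAt (x := V y)).comp y hV.hasFDerivAt).fderiv
  have h2 : fderiv ℝ (fun z => V z k) y = (ε k : Model n →L[ℝ] ℝ) ∘L fderiv ℝ V y := h
  rw [h2]
  rfl

/-- The Schouten bracket `½ [π, π]` in coordinates. -/
theorem half_schouten_eq {p : Model n → (Model n →L[ℝ] ℝ) → Model n} {y : Model n}
    {P : Model n → Matrix (Fin n) (Fin n) ℝ} (hpP : ∀ z i j, (p z (ε j)) i = P z i j)
    (hd : ∀ j, DifferentiableAt ℝ (fun z => p z (ε j)) y) (hP : (P y)ᵀ = -P y)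
    (hP' : ∀ w, (matDeriv P y w)ᵀ = -matDeriv P y w) (a b c : Fin n) :
    (1 / 2) * schouten p y ![ε a, ε b, ε c] =
      ∑ l, (P y l a * matDeriv P y (e l) c b + P y l b * matDeriv P y (e l) a c
        + P y l c * matDeriv P y (e l) b a) := by
  set d := fun l => matDeriv P y (e l) with hdd
  have hd1 (w : Model n) (i j : Fin n) : (fderiv ℝ (fun z => p z (ε j)) y w) i
      = matDeriv P y w i j := by
    rw [fderiv_coord (hd j)]
    simp only [hpP]
    rfl
  have hsk (i j : Fin n) : P y i j = -P y j i := congrFun (congrFun hP j) i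
  have hdsk (l i j : Fin n) : d l i j = -d l j i := congrFun (congrFun (hP' (e l)) j) i
  -- `G a b c` is the derivative of the entry `P a c` along `π♯ ε^b`.
  set G : Fin n → Fin n → Fin n → ℝ := fun a b c => ∑ l, P y l b * d l a c with hG
  have hGsk (a b c : Fin n) : G a b c = -G c b a := by
    rw [hG, ← Finset.sum_neg_distrib]
    refine Finset.sum_congr rfl fun l _ => ?_
    rw [hdsk]; ring
  have b1 (i j : Fin n) : VectorField.lieBracket ℝ (fun _ : Model n => (e i : Model n))
      (fun _ => e j) y = 0 := by
    simp [VectorField.lieBracket]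
  have b2 (i j k : Fin n) : (VectorField.lieBracket ℝ (fun _ : Model n => (e i : Model n))
      (fun z => p z (ε j)) y) k = d i k j := by
    simp [VectorField.lieBracket, hd1, hdd]
  have b3 (i j k : Fin n) : (VectorField.lieBracket ℝ (fun z => p z (ε i))
      (fun _ : Model n => (e j : Model n)) y) k = -d j k i := by
    simp [VectorField.lieBracket, hd1, hdd]
  have b4 (i j k : Fin n) : (VectorField.lieBracket ℝ (fun z => p z (ε i))
      (fun z => p z (ε j)) y) k = G k i j - G k j i := by
    simp only [VectorField.lieBracket, PiLp.sub_apply, hd1, hG]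
    rw [matDeriv_eq_sum, matDeriv_eq_sum P y (p y (ε j))]
    simp only [hpP, hdd]
  have key : ∑ i, ∑ j,
      (wedge₃ (VectorField.lieBracket ℝ (fun _ : Model n => (e i : Model n)) (fun _ => e j) y)
          (p y (ε i)) (p y (ε j)) ![ε a, ε b, ε c]
        - wedge₃ (VectorField.lieBracket ℝ (fun _ : Model n => (e i : Model n))
          (fun z => p z (ε j)) y) (p y (ε i)) (e j) ![ε a, ε b, ε c]
        - wedge₃ (VectorField.lieBracket ℝ (fun z => p z (ε i))
          (fun _ : Model n => (e j : Model n)) y) (e i) (p y (ε j)) ![ε a, ε b, ε c]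
        + wedge₃ (VectorField.lieBracket ℝ (fun z => p z (ε i)) (fun z => p z (ε j)) y)
          (e i) (e j) ![ε a, ε b, ε c]) = 8 * (G a b c + G b c a + G c a b) := by
    -- Each of the two mixed families of brackets contributes twice the cyclic sum of `G` and the
    -- `[V_i, V_j]` family four times, which gives the `8`; the constant fields commute.
    have f2 (a b c : Fin n) : ∑ i, ∑ j, d i a j * P y b i * (e j : Model n) c = -G a b c := by
      simp only [e_apply, mul_ite, mul_one, mul_zero, Finset.sum_ite_eq, Finset.mem_univ, if_true,
        hG]
      rw [← Finset.sum_neg_distrib]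
      refine Finset.sum_congr rfl fun l _ => ?_
      rw [hsk b l]; ring
    have f3 (a b c : Fin n) : ∑ i, ∑ j, d j a i * (e i : Model n) b * P y c j = -G a c b := by
      rw [Finset.sum_comm, ← f2 a c b]
      refine Finset.sum_congr rfl fun l _ => Finset.sum_congr rfl fun k _ => ?_
      ring
    have f4 (a b c : Fin n) : ∑ i, ∑ j, (G a i j - G a j i) * (e i : Model n) b * (e j : Model n) c
        = G a b c - G a c b := by
      simp [e_apply]
    have expand (i j : Fin n) :
        (wedge₃ (VectorField.lieBracket ℝ (fun _ : Model n => (e i : Model n)) (fun _ => e j) y)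
          (p y (ε i)) (p y (ε j)) ![ε a, ε b, ε c]
        - wedge₃ (VectorField.lieBracket ℝ (fun _ : Model n => (e i : Model n))
          (fun z => p z (ε j)) y) (p y (ε i)) (e j) ![ε a, ε b, ε c]
        - wedge₃ (VectorField.lieBracket ℝ (fun z => p z (ε i))
          (fun _ : Model n => (e j : Model n)) y) (e i) (p y (ε j)) ![ε a, ε b, ε c]
        + wedge₃ (VectorField.lieBracket ℝ (fun z => p z (ε i)) (fun z => p z (ε j)) y)
          (e i) (e j) ![ε a, ε b, ε c]) =
        (-(d i a j * P y b i * (e j : Model n) c) + d i a j * P y c i * (e j : Model n) b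
          + d i b j * P y a i * (e j : Model n) c - d i c j * P y a i * (e j : Model n) b
          - d i b j * P y c i * (e j : Model n) a + d i c j * P y b i * (e j : Model n) a)
        + (d j a i * (e i : Model n) b * P y c j - d j a i * (e i : Model n) c * P y b j
          - d j b i * (e i : Model n) a * P y c j + d j c i * (e i : Model n) a * P y b j
          + d j b i * (e i : Model n) c * P y a j - d j c i * (e i : Model n) b * P y a j)
        + ((G a i j - G a j i) * (e i : Model n) b * (e j : Model n) c
          - (G a i j - G a j i) * (e i : Model n) c * (e j : Model n) b
          - (G b i j - G b j i) * (e i : Model n) a * (e j : Model n) c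
          + (G c i j - G c j i) * (e i : Model n) a * (e j : Model n) b
          + (G b i j - G b j i) * (e i : Model n) c * (e j : Model n) a
          - (G c i j - G c j i) * (e i : Model n) b * (e j : Model n) a) := by
      simp only [wedge₃_ε, b1, b2, b3, b4, hpP, PiLp.zero_apply]
      ring
    simp only [expand, Finset.sum_add_distrib, Finset.sum_sub_distrib, Finset.sum_neg_distrib,
      f2, f3, f4]
    linarith [hGsk a b c, hGsk b c a, hGsk c a b]
  have h : schouten p y ![ε a, ε b, ε c] = (1 / 4) * (8 * (G a b c + G b c a + G c a b)) := by
    rw [← key]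
    rfl
  rw [h]
  simp only [Finset.sum_add_distrib]
  simp only [hG, hdd]
  ring

/-- The six terms of the determinant agree after relabelling, since `ψ` is alternating; this cancels
the `1/6`. -/
theorem wedgeSharp₃_eq (p : (Model n →L[ℝ] ℝ) → Model n) (ψ : Model n [⋀^Fin 3]→L[ℝ] ℝ)
    {P : Matrix (Fin n) (Fin n) ℝ} (hpP : ∀ i j, (p (ε j)) i = P i j) (a b c : Fin n) :
    wedgeSharp₃ p ψ ![ε a, ε b, ε c] =
      ∑ k, ∑ l, ∑ r, ψ ![e k, e l, e r] * (P a k * P b l * P c r) := by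
  have s1 (k l r : Fin n) : ψ ![e k, e l, e r] = -ψ ![e l, e k, e r] := by
    have h := ψ.toAlternatingMap.map_swap ![e l, e k, e r] (i := 0) (j := 1) (by decide)
    rw [← ContinuousAlternatingMap.coe_toAlternatingMap, ← h]
    congr 1
    ext1 i; fin_cases i <;> rfl
  have s2 (k l r : Fin n) : ψ ![e k, e l, e r] = -ψ ![e k, e r, e l] := by
    have h := ψ.toAlternatingMap.map_swap ![e k, e r, e l] (i := 1) (j := 2) (by decide)
    rw [← ContinuousAlternatingMap.coe_toAlternatingMap, ← h]
    congr 1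
    ext1 i; fin_cases i <;> rfl
  set Φ : Fin n → Fin n → Fin n → ℝ := fun k l r => ψ ![e k, e l, e r] with hΦ
  have t1 (a b c : Fin n) : ∑ k, ∑ l, ∑ r, Φ k l r * (P b k * P a l * P c r)
      = -∑ k, ∑ l, ∑ r, Φ k l r * (P a k * P b l * P c r) := by
    rw [Finset.sum_comm]
    simp only [← Finset.sum_neg_distrib]
    refine Finset.sum_congr rfl fun k _ => Finset.sum_congr rfl fun l _ =>
      Finset.sum_congr rfl fun r _ => ?_
    simp only [hΦ]
    rw [s1 l k r]; ring
  have t2 (a b c : Fin n) : ∑ k, ∑ l, ∑ r, Φ k l r * (P a k * P c l * P b r)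
      = -∑ k, ∑ l, ∑ r, Φ k l r * (P a k * P b l * P c r) := by
    simp only [← Finset.sum_neg_distrib]
    refine Finset.sum_congr rfl fun k _ => ?_
    rw [Finset.sum_comm]
    refine Finset.sum_congr rfl fun l _ => Finset.sum_congr rfl fun r _ => ?_
    simp only [hΦ]
    rw [s2 k r l]; ring
  have expand (k l r : Fin n) :
      Φ k l r * wedge₃ (p (ε k)) (p (ε l)) (p (ε r)) ![ε a, ε b, ε c] =
        Φ k l r * (P a k * P b l * P c r) - Φ k l r * (P a k * P c l * P b r)
        - Φ k l r * (P b k * P a l * P c r) + Φ k l r * (P c k * P a l * P b r)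
        + Φ k l r * (P b k * P c l * P a r) - Φ k l r * (P c k * P b l * P a r) := by
    rw [wedge₃_ε]
    simp only [hpP]
    ring
  have h : wedgeSharp₃ p ψ ![ε a, ε b, ε c] = (1 / 6) * ∑ k, ∑ l, ∑ r,
      Φ k l r * wedge₃ (p (ε k)) (p (ε l)) (p (ε r)) ![ε a, ε b, ε c] := rfl
  rw [h]
  simp only [expand, Finset.sum_add_distrib, Finset.sum_sub_distrib]
  -- Chains of adjacent transpositions reach the five nontrivial orders of `a, b, c`.
  linarith [t1 a b c, t2 a b c, t1 a c b, t2 b a c, t1 b c a]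

/-- The twisted Jacobi identity, contracted with a covector `a`. -/
theorem contract_jacobi {P : Matrix (Fin n) (Fin n) ℝ} {d : Fin n → Matrix (Fin n) (Fin n) ℝ}
    {Φ : Fin n → Fin n → Fin n → ℝ} (hP : Pᵀ = -P) (hd : ∀ l, (d l)ᵀ = -d l)
    (hΦ : ∀ k l r, Φ k l r = -Φ k r l)
    (hJ : ∀ a b c, ∑ l, (P l a * d l c b + P l b * d l a c + P l c * d l b a) =
      ∑ k, ∑ l, ∑ r, Φ k l r * (P a k * P b l * P c r)) (a : Fin n → ℝ)
    {A R Ψ : Matrix (Fin n) (Fin n) ℝ}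
    (hA : ∀ i j, A i j = ∑ l, (P *ᵥ a) l * d l i j)
    (hR : R = (Matrix.of fun i l => (d l *ᵥ a) i) * P)
    (hΨ : ∀ k l, Ψ k l = ∑ r, (P *ᵥ a) r * Φ r l k) :
    R - Rᵀ - A = -(P * Ψ * P) := by
  have hsk (i j : Fin n) : P i j = -P j i := congrFun (congrFun hP j) i
  have hdsk (l i j : Fin n) : d l i j = -d l j i := congrFun (congrFun (hd l) j) i
  ext i j
  -- The first free index is contracted with `a`; the three cyclic terms become `-A`, `-Rᵀ` and `R`.
  have h := Finset.sum_congr rfl fun (k : Fin n) (_ : k ∈ Finset.univ) =>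
    congrArg (a k * ·) (hJ k i j)
  have r1 (i j : Fin n) : R i j = ∑ k, ∑ l, a k * (P l j * d l i k) := by
    rw [hR, mul_apply, Finset.sum_comm]
    refine Finset.sum_congr rfl fun l _ => ?_
    simp only [of_apply, mulVec, dotProduct, Finset.sum_mul]
    exact Finset.sum_congr rfl fun k _ => by ring
  have a1 : A i j = -∑ k, ∑ l, a k * (P l k * d l j i) := by
    rw [hA, Finset.sum_comm, ← Finset.sum_neg_distrib]
    refine Finset.sum_congr rfl fun l _ => ?_
    simp only [mulVec, dotProduct, Finset.sum_mul, ← Finset.sum_neg_distrib]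
    exact Finset.sum_congr rfl fun k _ => by rw [hdsk l i j]; ring
  have r2 : R j i = -∑ k, ∑ l, a k * (P l i * d l k j) := by
    rw [r1]
    simp only [← Finset.sum_neg_distrib]
    exact Finset.sum_congr rfl fun k _ => Finset.sum_congr rfl fun l _ => by
      rw [hdsk l j k]; ring
  have q1 : (P * Ψ * P) i j = -∑ s, a s * ∑ k, ∑ l, ∑ r, Φ k l r * (P s k * P i l * P j r) := by
    have e1 : (P * Ψ * P) i j
        = ∑ r, ∑ l, ∑ k, ∑ s, -(a s * (Φ k l r * (P s k * P i l * P j r))) := by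
      rw [mul_apply]
      refine Finset.sum_congr rfl fun r _ => ?_
      rw [mul_apply, Finset.sum_mul]
      refine Finset.sum_congr rfl fun l _ => ?_
      rw [hΨ, Finset.mul_sum, Finset.sum_mul]
      refine Finset.sum_congr rfl fun k _ => ?_
      rw [mulVec, dotProduct, Finset.sum_mul, Finset.mul_sum, Finset.sum_mul]
      refine Finset.sum_congr rfl fun s _ => ?_
      -- Three sign changes, two from `P` and one from `Φ`, account for the minus sign in the
      -- conclusion.
      rw [hΦ k r l, hsk k s, hsk r j]; ring
    rw [e1]
    simp only [Finset.mul_sum, ← Finset.sum_neg_distrib]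
    calc _ = ∑ r, ∑ k, ∑ l, ∑ s, -(a s * (Φ k l r * (P s k * P i l * P j r))) :=
          Finset.sum_congr rfl fun r _ => Finset.sum_comm
      _ = ∑ k, ∑ r, ∑ l, ∑ s, -(a s * (Φ k l r * (P s k * P i l * P j r))) := Finset.sum_comm
      _ = ∑ k, ∑ l, ∑ r, ∑ s, -(a s * (Φ k l r * (P s k * P i l * P j r))) :=
          Finset.sum_congr rfl fun k _ => Finset.sum_comm
      _ = ∑ k, ∑ l, ∑ s, ∑ r, -(a s * (Φ k l r * (P s k * P i l * P j r))) :=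
          Finset.sum_congr rfl fun k _ => Finset.sum_congr rfl fun l _ => Finset.sum_comm
      _ = ∑ k, ∑ s, ∑ l, ∑ r, -(a s * (Φ k l r * (P s k * P i l * P j r))) :=
          Finset.sum_congr rfl fun k _ => Finset.sum_comm
      _ = _ := Finset.sum_comm
  rw [Matrix.sub_apply, Matrix.sub_apply, Matrix.neg_apply, transpose_apply, q1, ← h, neg_neg, r2,
    a1, r1 i j]
  simp only [Finset.mul_sum, mul_add, Finset.sum_add_distrib]
  ring

end Schouten

/-! ### Modular fields under gauge transformations. -/

section Modular

variable {n : ℕ} {M : Type*} [TopologicalSpace M] [ChartedSpace (Model n) M]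

theorem vec₂_comp {V W : Type*} (f : V → W) (u v : V) :
    (fun i => f ((![u, v] : Fin 2 → V) i)) = ![f u, f v] := by
  ext i; fin_cases i <;> rfl

theorem vec₃_comp {V W : Type*} (f : V → W) (u v w : V) :
    (fun i => f ((![u, v, w] : Fin 3 → V) i)) = ![f u, f v, f w] := by
  ext i; fin_cases i <;> rfl

theorem extDeriv_one_apply {τ : Model n → Model n [⋀^Fin 1]→L[ℝ] ℝ} {y : Model n}
    (hτ : DifferentiableAt ℝ τ y) (u v : Model n) :
    extDeriv τ y ![u, v]
      = fderiv ℝ (fun z => τ z ![v]) y u - fderiv ℝ (fun z => τ z ![u]) y v := by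
  have h0 : (0 : Fin 2).removeNth ![u, v] = ![v] := by ext1 i; fin_cases i; rfl
  have h1 : (1 : Fin 2).removeNth ![u, v] = ![u] := by ext1 i; fin_cases i; rfl
  rw [extDeriv_apply hτ, Fin.sum_univ_two, h0, h1]
  simp [sub_eq_add_neg]

theorem extDeriv_two_apply {τ : Model n → Model n [⋀^Fin 2]→L[ℝ] ℝ} {y : Model n}
    (hτ : DifferentiableAt ℝ τ y) (u v w : Model n) :
    extDeriv τ y ![u, v, w]
      = fderiv ℝ (fun z => τ z ![v, w]) y u - fderiv ℝ (fun z => τ z ![u, w]) y v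
        + fderiv ℝ (fun z => τ z ![u, v]) y w := by
  have h0 : (0 : Fin 3).removeNth ![u, v, w] = ![v, w] := by ext1 i; fin_cases i <;> rfl
  have h1 : (1 : Fin 3).removeNth ![u, v, w] = ![u, w] := by ext1 i; fin_cases i <;> rfl
  have h2 : (2 : Fin 3).removeNth ![u, v, w] = ![u, v] := by ext1 i; fin_cases i <;> rfl
  rw [extDeriv_apply hτ, Fin.sum_univ_three, h0, h1, h2]
  simp [sub_eq_add_neg]

theorem IsChartFrame.form_d {m : M} {L : Tan n m ≃L[ℝ] Model n}
    (hL : IsChartFrame m (extChartAt (𝓡 n) m m) m L) {k : ℕ} (τ : Form n M k)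
    (v : Fin (k + 1) → Tan n m) :
    τ.d m v = extDeriv (τ.inChart m) (extChartAt (𝓡 n) m m) (fun i => L (v i)) := by
  have h : τ.d m v = extDeriv (τ.inChart m) (extChartAt (𝓡 n) m m)
      (fun i => mfderiv (𝓡 n) 𝓘(ℝ, Model n) (extChartAt (𝓡 n) m) m (v i)) := rfl
  rw [h]
  simp only [hL.mfderiv_eq]

theorem Form.IsSmooth.differentiableAt {k : ℕ} {τ : Form n M k} (hτ : τ.IsSmooth) (m : M) :
    DifferentiableAt ℝ (τ.inChart m) (extChartAt (𝓡 n) m m) :=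
  ((hτ m).contDiffAt (extChartAt_target_mem_nhds m)).differentiableAt (by simp)

/-- The matrix of partial derivatives of the components of a `1`-form in the chart at `m`. -/
def jacobianMat (α : CovectorField n M) (m : M) : Matrix (Fin n) (Fin n) ℝ :=
  Matrix.of fun k l => fderiv ℝ (fun y => chartCoord α m y k) (extChartAt (𝓡 n) m m) (e l)

theorem trace_skew {G P : Matrix (Fin n) (Fin n) ℝ} (hP : Pᵀ = -P) :
    trace (Gᵀ * P) = -trace (G * P) := by
  rw [← trace_transpose, transpose_mul, hP, transpose_transpose, Matrix.neg_mul, trace_neg,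
    trace_mul_comm]

/-- The matrix of `dα` is `J - Jᵀ` with `J` the Jacobian; against a skew matrix both halves have the
same trace contribution, which cancels the factor `½`. -/
theorem interiorBivector_d {α : CovectorField n M} (hα : α.toForm.IsSmooth) {m : M}
    {L : Tan n m ≃L[ℝ] Model n} (hL : IsChartFrame m (extChartAt (𝓡 n) m m) m L)
    (π : SharpField n M) (hπ : (sharpMat L (π m))ᵀ = -sharpMat L (π m)) :
    interiorBivector π α.toForm.d m = trace (jacobianMat α m * sharpMat L (π m)) := by
  have h : flatMat L (flat (α.toForm.d m)) = jacobianMat α m - (jacobianMat α m)ᵀ := by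
    ext k l
    simp only [flatMat, of_apply, flat_apply, hL.form_d]
    rw [vec₂_comp, L.apply_symm_apply, L.apply_symm_apply,
      extDeriv_one_apply (hα.differentiableAt m)]
    rfl
  rw [interiorBivector, trace_flat_sharp L, h, Matrix.sub_mul, trace_sub, trace_skew hπ]
  ring

theorem matDeriv_one_add_mul {A A' : Model n → Matrix (Fin n) (Fin n) ℝ} {y : Model n}
    (hA : ∀ i j, DifferentiableAt ℝ (fun z => A z i j) y)
    (hA' : ∀ i j, DifferentiableAt ℝ (fun z => A' z i j) y) (w : Model n) :
    matDeriv (fun z => 1 + A z * A' z) y w = matDeriv A y w * A' y + A y * matDeriv A' y w := by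
  ext i j
  have h := HasFDerivAt.fun_sum (u := Finset.univ)
    fun k _ => (hA i k).hasFDerivAt.mul (hA' k j).hasFDerivAt
  have h2 := h.const_add ((1 : Matrix (Fin n) (Fin n) ℝ) i j)
  have h3 : fderiv ℝ (fun z => (1 + A z * A' z) i j) y = _ := h2.fderiv
  change fderiv ℝ (fun z => (1 + A z * A' z) i j) y w = _
  rw [h3, _root_.sum_apply, Matrix.add_apply, mul_apply, mul_apply, ← Finset.sum_add_distrib]
  refine Finset.sum_congr rfl fun k _ => ?_
  simp only [matDeriv, of_apply, _root_.add_apply, _root_.smul_apply, smul_eq_mul]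
  ring

theorem fderiv_mulVec {A : Model n → Matrix (Fin n) (Fin n) ℝ} {a : Model n → Fin n → ℝ}
    {y : Model n} (hA : ∀ i j, DifferentiableAt ℝ (fun z => A z i j) y)
    (ha : ∀ i, DifferentiableAt ℝ (fun z => a z i) y) (w : Model n) (k : Fin n) :
    fderiv ℝ (fun z => (A z *ᵥ a z) k) y w
      = (matDeriv A y w *ᵥ a y) k + (A y *ᵥ fun j => fderiv ℝ (fun z => a z j) y w) k := by
  have h := HasFDerivAt.fun_sum (u := Finset.univ)
    fun j _ => (hA k j).hasFDerivAt.mul (ha j).hasFDerivAt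
  have h3 : fderiv ℝ (fun z => (A z *ᵥ a z) k) y = _ := h.fderiv
  rw [h3, _root_.sum_apply, mulVec, dotProduct, mulVec, dotProduct, ← Finset.sum_add_distrib]
  refine Finset.sum_congr rfl fun k _ => ?_
  simp only [matDeriv, of_apply, _root_.add_apply, _root_.smul_apply, smul_eq_mul]
  ring

theorem flat₃_sub {m : M} (ψ φ : Tan n m [⋀^Fin 3]→L[ℝ] ℝ) (v : Tan n m) :
    flat₃ (ψ - φ) v = flat₃ ψ v - flat₃ φ v := by
  ext u w
  rw [flat₃_apply]
  have h : (flat₃ ψ v - flat₃ φ v) u w = flat₃ ψ v u w - flat₃ φ v u w := rfl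
  rw [h, flat₃_apply, flat₃_apply]
  rfl

theorem hamiltonian_add (π : SharpField n M) {f g : M → ℝ}
    (hf : ContMDiff (𝓡 n) 𝓘(ℝ, ℝ) ∞ f) (hg : ContMDiff (𝓡 n) 𝓘(ℝ, ℝ) ∞ g) (m : M) :
    hamiltonian π (fun x => f x + g x) m = hamiltonian π f m + hamiltonian π g m := by
  have h : differential (fun x => f x + g x) m = differential f m + differential (n := n) g m :=
    (((hf m).mdifferentiableAt (by simp)).hasMFDerivAt.add
      ((hg m).mdifferentiableAt (by simp)).hasMFDerivAt).mfderiv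
  have h2 := congrArg (π m) h
  rwa [map_add] at h2

theorem hamiltonian_neg (π : SharpField n M) (f : M → ℝ) (m : M) :
    hamiltonian π (fun x => -f x) m = -hamiltonian π f m := by
  have h : differential (fun x => -f x) m = -differential (n := n) f m := mfderiv_neg
  have h2 := congrArg (π m) h
  rwa [map_neg] at h2

/-- The matrix of `i_v dB`. -/
theorem flatMat_d {B : Form n M 2} (hB : B.IsSmooth) {m : M} {L : Tan n m ≃L[ℝ] Model n}
    (hL : IsChartFrame m (extChartAt (𝓡 n) m m) m L) (v : Tan n m)
    {C : Matrix (Fin n) (Fin n) ℝ} (hC : C = Matrix.of fun k l =>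
      (matDeriv (chartFlat B m) (extChartAt (𝓡 n) m m) (e l) *ᵥ (L v).ofLp) k) :
    flatMat L (flat₃ (B.d m) v)
      = matDeriv (chartFlat B m) (extChartAt (𝓡 n) m m) (L v) - C + Cᵀ := by
  set y₀ := extChartAt (𝓡 n) m m
  have hdB := hB.differentiableAt m
  -- The vector `v` stays constant in the chart, so only the coefficients of `B` are differentiated.
  have hlin (k : Fin n) (w : Model n) :
      fderiv ℝ (fun z => B.inChart m z ![L v, e k]) y₀ w
        = (matDeriv (chartFlat B m) y₀ w *ᵥ (L v).ofLp) k := by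
    have hd (u : Fin 2 → Model n) :
        DifferentiableAt ℝ (fun z => B.inChart m z u) y₀ :=
      (ContinuousAlternatingMap.apply ℝ (Model n) ℝ u).differentiableAt.comp y₀ hdB
    have hexp : (fun z => B.inChart m z ![L v, e k])
        = fun z => (chartFlat B m z *ᵥ (L v).ofLp) k := by
      ext z
      let T : Model n →ₗ[ℝ] ℝ :=
        { toFun := fun u => B.inChart m z ![u, e k]
          map_add' := fun u u' => (B.inChart m z).toMultilinearMap.cons_add ![e k] u u'
          map_smul' := fun a u => (B.inChart m z).toMultilinearMap.cons_smul ![e k] a u }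
      have hT : T (L v) = T (∑ r, (L v) r • e r) := congrArg T (vector_eq_sum (L v))
      rw [map_sum] at hT
      simp only [map_smul, smul_eq_mul] at hT
      refine hT.trans (Finset.sum_congr rfl fun r _ => mul_comm _ _)
    rw [hexp, fderiv_mulVec (A := chartFlat B m) (a := fun _ => (L v).ofLp)
      (fun i j => hd ![e j, e i]) (fun i => differentiableAt_const _)]
    simp [mulVec, dotProduct]
  ext k l
  simp only [flatMat, of_apply, flat₃_apply]
  rw [hL.form_d, vec₃_comp, L.apply_symm_apply, L.apply_symm_apply, extDeriv_two_apply hdB, hlin,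
    hlin, hC]
  rfl

variable [IsManifold (𝓡 n) ∞ M]

theorem chartSharp_transpose {π : SharpField n M} (hπ : IsBivectorField π) {c : M}
    {y : Model n} (hy : y ∈ (extChartAt (𝓡 n) c).target) :
    (chartSharp π c y)ᵀ = -chartSharp π c y := by
  obtain ⟨L, hL⟩ := exists_isChartFrame hy rfl
  rw [hL.chartSharp, sharpMat_transpose hπ]

/-- Skewness holds on a whole neighbourhood in the chart, hence passes to derivatives. -/
theorem matDeriv_chartSharp_transpose {π : SharpField n M} (hπ : IsBivectorField π) (m : M)
    (w : Model n) :
    (matDeriv (chartSharp π m) (extChartAt (𝓡 n) m m) w)ᵀ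
      = -matDeriv (chartSharp π m) (extChartAt (𝓡 n) m m) w := by
  ext i j
  have h : (fun y => chartSharp π m y j i) =ᶠ[𝓝 (extChartAt (𝓡 n) m m)]
      fun y => -chartSharp π m y i j := by
    filter_upwards [extChartAt_target_mem_nhds (I := 𝓡 n) m] with y hy
    exact congrFun (congrFun (chartSharp_transpose hπ hy) i) j
  simp only [matDeriv, transpose_apply, of_apply, Matrix.neg_apply, h.fderiv_eq]
  rw [fderiv_fun_neg]
  rfl

/-- The Leibniz rule separates the derivatives of `σ_B` from those of `α`; the latter appear only as
`S J`, which is what lets them cancel later. -/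
theorem jacobianMat_gaugeEnd {π : SharpField n M} (hπ : IsBivectorField π) {B : Form n M 2}
    (hB : B.IsSmooth) {α : CovectorField n M} (hα : α.toForm.IsSmooth) (m : M) :
    jacobianMat (fun x => gaugeEnd π B x (α x)) m
      = (Matrix.of fun k l => (matDeriv (chartGauge π B m) (extChartAt (𝓡 n) m m) (e l) *ᵥ
          chartCoord α m (extChartAt (𝓡 n) m m)) k)
        + chartGauge π B m (extChartAt (𝓡 n) m m) * jacobianMat α m := by
  have hnhds : (extChartAt (𝓡 n) m).target ∈ 𝓝 (extChartAt (𝓡 n) m m) :=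
    extChartAt_target_mem_nhds m
  ext k l
  have h : (fun y => chartCoord (fun x => gaugeEnd π B x (α x)) m y k)
      =ᶠ[𝓝 (extChartAt (𝓡 n) m m)] fun y => (chartGauge π B m y *ᵥ chartCoord α m y) k := by
    filter_upwards [hnhds] with y hy
    rw [chartCoord_gauge π B α hy]
  simp only [jacobianMat, of_apply, h.fderiv_eq]
  rw [fderiv_mulVec
    (fun i j => ((contDiffOn_chartGauge hπ hB m i j).contDiffAt hnhds).differentiableAt (by simp))
    (fun i => (((isSmooth_toForm_iff α).1 hα m i).contDiffAt hnhds).differentiableAt (by simp))]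
  rfl

/-- The twisted Jacobi identity in the chart at `m`, contracted with a covector `a`. -/
theorem IsTwistedPoisson.jacobi_matrix {π : SharpField n M} {ψ : Form n M 3}
    (h : IsTwistedPoisson π ψ) {m : M} {L : Tan n m ≃L[ℝ] Model n}
    (hL : IsChartFrame m (extChartAt (𝓡 n) m m) m L) (α : Cotan n m)
    {R : Matrix (Fin n) (Fin n) ℝ}
    (hR : R = (Matrix.of fun i l =>
      (matDeriv (chartSharp π m) (extChartAt (𝓡 n) m m) (e l) *ᵥ covCoord L α) i)
        * sharpMat L (π m)) :
    R - Rᵀ - matDeriv (chartSharp π m) (extChartAt (𝓡 n) m m) (L (π m α))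
      = -(sharpMat L (π m) * flatMat L (flat₃ (ψ m) (π m α)) * sharpMat L (π m)) := by
  have hnhds : (extChartAt (𝓡 n) m).target ∈ 𝓝 (extChartAt (𝓡 n) m m) :=
    extChartAt_target_mem_nhds m
  set y₀ := extChartAt (𝓡 n) m m
  have hv : (L (π m α)).ofLp = sharpMat L (π m) *ᵥ covCoord L α := by
    ext i
    exact sharpMat_mulVec L (π m) α i
  refine contract_jacobi (d := fun l => matDeriv (chartSharp π m) y₀ (e l))
    (Φ := fun k l r => ψ.inChart m y₀ ![e k, e l, e r]) (sharpMat_transpose h.bivector L)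
    (fun l => matDeriv_chartSharp_transpose h.bivector m _) (fun k l r => ?_) (fun a b c => ?_)
    (covCoord L α) (fun i j => ?_) hR (fun k l => ?_)
  · have hs := (ψ.inChart m y₀).toAlternatingMap.map_swap ![e k, e r, e l] (i := 1) (j := 2)
      (by decide)
    rw [← ContinuousAlternatingMap.coe_toAlternatingMap, ← hs]
    congr 1
    ext1 i; fin_cases i <;> rfl
  -- Coordinate covectors suffice: the contraction with `α` is done afterwards.
  · have hj := h.jacobi m ![ε a, ε b, ε c]
    rw [half_schouten_eq (P := chartSharp π m) (fun z i j => rfl)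
      (fun j => ((h.bivector.smooth m (ε j)).contDiffAt hnhds).differentiableAt (by simp))
      (chartSharp_transpose h.bivector (mem_extChartAt_target m))
      (matDeriv_chartSharp_transpose h.bivector m),
      wedgeSharp₃_eq (P := chartSharp π m y₀) _ _ (fun i j => rfl), hL.chartSharp] at hj
    exact hj
  · rw [matDeriv_eq_sum, hv]
  · simp only [flatMat, of_apply, flat₃_apply, hL.form, vec₃_comp]
    let T : Tan n m →ₗ[ℝ] ℝ :=
      { toFun := fun u => ψ m ![u, L.symm (e l), L.symm (e k)]
        map_add' := fun u u' => (ψ m).toMultilinearMap.cons_add ![L.symm (e l), L.symm (e k)] u u'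
        map_smul' := fun a u =>
          (ψ m).toMultilinearMap.cons_smul ![L.symm (e l), L.symm (e k)] a u }
    have hT : T (π m α) = T (∑ r, (L (π m α)) r • L.symm (e r)) :=
      congrArg T (tangent_eq_sum L (π m α))
    rw [map_sum, hv] at hT
    simp only [map_smul, smul_eq_mul] at hT
    exact hT

/-- The behaviour of `i_π dα` and of `Y` under a gauge transformation. -/
theorem interiorBivector_gauge {π : SharpField n M} {ψ : Form n M 3}
    (hπψ : IsTwistedPoisson π ψ) {B : Form n M 2} (hB : B.IsSmooth)
    (hσ : ∀ x, IsUnit (gaugeEnd π B x)) {α : CovectorField n M} (hα : α.toForm.IsSmooth) (m : M) :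
    gaugeEnd π B m (α m) (Y (gaugeBivector π B) (gaugeForm ψ B) m) - α m (Y π ψ m)
        - (interiorBivector (gaugeBivector π B)
            (CovectorField.toForm fun x => gaugeEnd π B x (α x)).d m
          - interiorBivector π α.toForm.d m)
      = α m (hamiltonian π (gaugePotential π B) m) := by
  have hπ := hπψ.bivector
  have hnhds : (extChartAt (𝓡 n) m).target ∈ 𝓝 (extChartAt (𝓡 n) m m) :=
    extChartAt_target_mem_nhds m
  obtain ⟨L, hL⟩ := exists_isChartFrame (mem_extChartAt_target (I := 𝓡 n) m)
    ((extChartAt (𝓡 n) m).left_inv (mem_extChartAt_source m))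
  have hham : α m (hamiltonian π (gaugePotential π B) m)
      = -differential (gaugePotential π B) m (π m (α m)) :=
    hπ.skew m _ _
  have hm := differential_gaugePotential hπ hB hσ m hL (π m (α m))
  have hJ := hπψ.jacobi_matrix hL (α m) rfl
  have hdB := flatMat_d hB hL (π m (α m)) rfl
  have hS := hL.chartGauge π B
  have hunit : IsUnit (chartGauge π B m (extChartAt (𝓡 n) m m)).det :=
    isUnit_det_chartGauge hσ (mem_extChartAt_target m)
  have hP' := sharpMat_gauge (hσ m) L
  have hPt := sharpMat_transpose hπ L
  have hbt := flatMat_transpose (B m) L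
  have hP't := gauge_transpose hPt hbt rfl (hS ▸ hunit) hP'
  have hY' : gaugeEnd π B m (α m) (Y (gaugeBivector π B) (gaugeForm ψ B) m)
      = (1 / 2) * trace ((flatMat L (flat₃ (ψ m) (π m (α m)))
          - flatMat L (flat₃ (B.d m) (π m (α m)))) * sharpMat L (gaugeBivector π B m)) := by
    rw [apply_Y, gaugeBivector_gaugeEnd (hσ m), trace_flat_sharp L, gaugeForm, flat₃_sub]
    rfl
  have hY : α m (Y π ψ m)
      = (1 / 2) * trace (flatMat L (flat₃ (ψ m) (π m (α m))) * sharpMat L (π m)) := by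
    rw [apply_Y, trace_flat_sharp L]
  set y₀ := extChartAt (𝓡 n) m m
  have hdS (w : Model n) : matDeriv (chartGauge π B m) y₀ w
      = matDeriv (chartFlat B m) y₀ w * sharpMat L (π m)
        + flatMat L (flat (B m)) * matDeriv (chartSharp π m) y₀ w := by
    rw [← hL.chartSharp, ← hL.chartFlat]
    exact matDeriv_one_add_mul
      (fun i j => ((contDiffOn_form_apply hB m ![e j, e i]).contDiffAt hnhds).differentiableAt
        (by simp))
      (fun i j => ((contDiffOn_chartSharp hπ m i j).contDiffAt hnhds).differentiableAt (by simp)) w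
  have hint : interiorBivector (gaugeBivector π B)
        (CovectorField.toForm fun x => gaugeEnd π B x (α x)).d m
      - interiorBivector π α.toForm.d m
      = trace (((Matrix.of fun k l =>
          (matDeriv (chartFlat B m) y₀ (e l) *ᵥ (L (π m (α m))).ofLp) k)
        + flatMat L (flat (B m)) * Matrix.of fun i l =>
          (matDeriv (chartSharp π m) y₀ (e l) *ᵥ covCoord L (α m)) i)
        * sharpMat L (gaugeBivector π B m)) := by
    have hv : (L (π m (α m))).ofLp = sharpMat L (π m) *ᵥ covCoord L (α m) := by
      ext i
      exact sharpMat_mulVec L (π m) (α m) i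
    have hW : (Matrix.of fun k l =>
          (matDeriv (chartGauge π B m) y₀ (e l) *ᵥ chartCoord α m y₀) k)
        = (Matrix.of fun k l => (matDeriv (chartFlat B m) y₀ (e l) *ᵥ (L (π m (α m))).ofLp) k)
        + flatMat L (flat (B m)) * Matrix.of fun i l =>
          (matDeriv (chartSharp π m) y₀ (e l) *ᵥ covCoord L (α m)) i := by
      ext k l
      rw [hL.chartCoord, hv]
      simp only [of_apply, hdS, add_mulVec, ← mulVec_mulVec, Pi.add_apply, Matrix.add_apply]
      rfl
    -- By cyclicity `tr (S J P') = tr (J P' S) = tr (J P)`, which is `i_π dα`: the derivatives of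
    -- `α` disappear.
    rw [interiorBivector_d (isSmooth_gaugeEnd hπ hB hα) hL _ hP't, interiorBivector_d hα hL _ hPt,
      jacobianMat_gaugeEnd hπ hB hα, hW, Matrix.add_mul _ (_ * _), trace_add, hS,
      trace_mul_comm (_ * _), ← Matrix.mul_assoc, hP', trace_mul_comm (sharpMat L (π m)),
      add_sub_cancel_right]
  have key := trace_gauge_identity hPt hbt hS hunit (hS ▸ hP') rfl hJ
    (D := matDeriv (chartFlat B m) y₀ (L (π m (α m))))
    (C := Matrix.of fun k l => (matDeriv (chartFlat B m) y₀ (e l) *ᵥ (L (π m (α m))).ofLp) k)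
  have hm' : differential (gaugePotential π B) m (π m (α m))
      = (1 / 2) * trace ((chartGauge π B m y₀)⁻¹ *
        (matDeriv (chartFlat B m) y₀ (L (π m (α m))) * sharpMat L (π m)
        + flatMat L (flat (B m)) * matDeriv (chartSharp π m) y₀ (L (π m (α m))))) := by
    rw [← hdS]
    exact hm
  rw [hham, hm', hint, hY', hY, hdB, key]
  ring

/-- Modular fields of `π` and of its gauge transform, for the same volume. -/
theorem isX_gauge_iff {π : SharpField n M} {ψ : Form n M 3}
    (hπψ : IsTwistedPoisson π ψ) {B : Form n M 2} (hB : B.IsSmooth)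
    (hσ : ∀ x, IsUnit (gaugeEnd π B x)) (μ : VolumeField n M) {V V' : VectorField n M}
    (hV : ∀ m, V' m + Y (gaugeBivector π B) (gaugeForm ψ B) m
        + π m (flat (B m) (V' m + Y (gaugeBivector π B) (gaugeForm ψ B) m))
      = V m + Y π ψ m + hamiltonian π (gaugePotential π B) m) :
    IsX (gaugeBivector π B) μ V' ↔ IsX π μ V := by
  have hπ := hπψ.bivector
  have step {α : CovectorField n M} (hα : α.toForm.IsSmooth) (m : M) (v : Fin n → Tan n m) :
      (gaugeEnd π B m (α m) (V' m) * μ m v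
        = lieDeriv (fun x => gaugeBivector π B x (gaugeEnd π B x (α x))) μ m v
          - interiorBivector (gaugeBivector π B)
            (CovectorField.toForm fun x => gaugeEnd π B x (α x)).d m * μ m v)
      ↔ (α m (V m) * μ m v = lieDeriv (fun x => π x (α x)) μ m v
          - interiorBivector π α.toForm.d m * μ m v) := by
    have h1 := interiorBivector_gauge hπψ hB hσ hα m
    have h2 := congrArg (α m) (hV m)
    rw [← gaugeEnd_apply_apply hπ, map_add, map_add, map_add] at h2
    have h3 : gaugeEnd π B m (α m) (V' m) = α m (V m)
        - (interiorBivector (gaugeBivector π B)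
            (CovectorField.toForm fun x => gaugeEnd π B x (α x)).d m
          - interiorBivector π α.toForm.d m) := by linarith
    have h4 : (fun x => gaugeBivector π B x (gaugeEnd π B x (α x))) = fun x => π x (α x) :=
      funext fun x => gaugeBivector_gaugeEnd (hσ x) (α x)
    rw [h3, h4, sub_mul, sub_mul]
    constructor <;> intro h <;> linarith
  refine ⟨fun h α hα m v => (step hα m v).1 (h _ (isSmooth_gaugeEnd hπ hB hα) m v),
    fun h β hβ m v => ?_⟩
  -- Every smooth `β` is `σ_B α` for a smooth `α`, so testing on the forms `σ_B α` loses nothing.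
  set α : CovectorField n M := fun x => Ring.inverse (gaugeEnd π B x) (β x) with hαdef
  have hβα : β = fun x => gaugeEnd π B x (α x) := by
    funext x
    exact (LinearMap.congr_fun (Ring.mul_inverse_cancel _ (hσ x)) (β x)).symm
  rw [hβα] at hβ ⊢
  have hα := isSmooth_of_gaugeEnd hπ hB hσ hβ
  exact (step hα m v).2 (h α hα m v)

end Modular

end TwistedPoisson

end

/-! ### The correspondence of modular classes. -/

theorem mainTheorem8 {n : ℕ} {M : Type*} [TopologicalSpace M] [T2Space M]
    [SecondCountableTopology M] [ChartedSpace (EuclideanSpace ℝ (Fin n)) M]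
    [IsManifold (𝓡 n) ∞ M]
    (π : TwistedPoisson.SharpField n M) (ψ : TwistedPoisson.Form n M 3)
    (hπψ : TwistedPoisson.IsTwistedPoisson π ψ)
    (B : TwistedPoisson.Form n M 2) (hB : B.IsSmooth)
    (hσ : ∀ m : M, IsUnit (TwistedPoisson.gaugeEnd π B m))
    (X : TwistedPoisson.VectorField n M) (hX : X.IsSmooth) :
    TwistedPoisson.InModularClass (TwistedPoisson.gaugeBivector π B)
        (TwistedPoisson.gaugeForm ψ B) X ↔
      TwistedPoisson.InModularClass π ψ
        (fun m => X m + π m (TwistedPoisson.flat (B m) (X m))) := by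
  open TwistedPoisson in
  have hpot := contMDiff_gaugePotential hπψ.bivector hB hσ
  have hham (g : M → ℝ) (m : M) : hamiltonian (gaugeBivector π B) g m
      + π m (flat (B m) (hamiltonian (gaugeBivector π B) g m)) = hamiltonian π g m :=
    gaugeBivector_add (hσ m) _
  constructor
  · rintro ⟨μ, Z, g, hμ, ⟨V', hV', rfl⟩, hg, hXZ⟩
    have hZ (m : M) : V' m + Y (gaugeBivector π B) (gaugeForm ψ B) m
        = X m + hamiltonian (gaugeBivector π B) g m :=
      sub_eq_iff_eq_add.1 (hXZ m).symm
    -- `V` is solved for from `σ_Bᵀ Z' = V + Y + H_f`, using `Z' = X + H'_g` and `σ_Bᵀ H'_g = H_g`.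
    -- The new potential is then `g - f`.
    let V : TwistedPoisson.VectorField n M := fun m => X m + π m (flat (B m) (X m))
      + hamiltonian π g m - Y π ψ m - hamiltonian π (gaugePotential π B) m
    refine ⟨μ, _, fun x => g x + -gaugePotential π B x, hμ, ⟨V, ?_, rfl⟩, hg.add hpot.neg,
      fun m => ?_⟩
    · refine (isX_gauge_iff hπψ hB hσ μ fun m => ?_).1 hV'
      rw [hZ, map_add, map_add]
      simp only [V, ← hham g]
      abel
    · rw [hamiltonian_add π hg hpot.neg, hamiltonian_neg]
      simp only [V]
      abel
  · rintro ⟨μ, Z, g, hμ, ⟨V, hV, rfl⟩, hg, hXZ⟩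
    -- Here `Z'` has to be `X + H'_{g + f}`: applying `σ_Bᵀ` gives `(Z - H_g) + H_{g + f} = Z +
    -- H_f`.
    let V' : TwistedPoisson.VectorField n M := fun m => X m
      + hamiltonian (gaugeBivector π B) (fun x => g x + gaugePotential π B x) m
      - Y (gaugeBivector π B) (gaugeForm ψ B) m
    refine ⟨μ, _, fun x => g x + gaugePotential π B x, hμ, ⟨V', ?_, rfl⟩, hg.add hpot,
      fun m => ?_⟩
    · refine (isX_gauge_iff hπψ hB hσ μ fun m => ?_).2 hV
      have h : V' m + Y (gaugeBivector π B) (gaugeForm ψ B) m = X m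
          + hamiltonian (gaugeBivector π B) (fun x => g x + gaugePotential π B x) m := by
        simp only [V']; abel
      rw [h, map_add, map_add, add_add_add_comm, hham, hamiltonian_add π hg hpot]
      have hX' : X m + π m (flat (B m) (X m)) = V m + Y π ψ m - hamiltonian π g m := hXZ m
      rw [hX']
      abel
    · simp only [V']
      abel
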